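/- Conventions. A compact space is a non-empty compact Hausdorff space; a compact metric space is likewise non-empty. For a compact space $X$, $C(X)$ is the algebra of continuous complex-valued functions on $X$ with the supremum norm $\|\cdot\|_X$. A uniform algebra on $X$ is a closed subalgebra of $C(X)$ that contains the constants and separates the points of $X$. Let $B$ be a uniform algebra on $X$. $B$ is nontrivial if $B\neq C(X)$. $B$ is essential if $X$ is the smallest closed set $E\subseteq X$ such that $B$ contains every $f\in C(X)$ vanishing on $E$. $B$ is natural if every non-zero multiplicative linear functional on $B$ is evaluation at a point of $X$. $B$ is regular on $X$ if for every closed $E\subseteq X$ and $x\in X\setminus E$ there is $f\in B$ with $f(x)=1$ and $f=0$ on $E$. $B$ is normal if it is natural and for all disjoint closed $E,F\subseteq X$ there is $f\in B$ with $f=0$ on $E$ and $f=1$ on $F$. A point $x$ is a peak point for $B$ if there is $f\in B$ with $f(x)=1$ and $|f(y)|<1$ for all $y\ne x$. For $x\in X$ put $M_x=\{f\in B: f(x)=0\}$ and $J_x=\{f\in B: f^{-1}(\{0\})\text{ is a neighborhood of }x\}$. $B$ is strongly regular at $x$ if $J_x$ is dense in $M_x$; $B$ satisfies Ditkin's condition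 at $x$ if for all $f\in M_x$ and $\varepsilon>0$ there is $g\in J_x$ with $\|gf-f\|_X<\varepsilon$; $B$ has bounded relative units at $x$ with bound $C\ge 1$ if for every compact $F\subseteq X\setminus\{x\}$ there is $f\in J_x$ with $\|f\|_X\le C$ and $f=1$ on $F$. $B$ is strongly regular (respectively a Ditkin algebra) if it is strongly regular (respectively satisfies Ditkin's condition) at every point of $X$; $B$ has bounded relative units if at every $x\in X$ it has bounded relative units with some bound $C\ge1$ (possibly depending on $x$). Theorem. Let $A$ be a nontrivial uniform algebra on a compact space $K$. Let $X$ be a compact metric space every non-empty open subset of which contains a nowhere dense subspace homeomorphic to $K$. Then there exists a sequence $(K_n)_{n\ge1}$ of pairwise disjoint, nowhere dense subspaces of $X$, each homeomorphic to $K$, such that $\bigcup_n K_n$ is dense in $X$ and $\operatorname{diam}(K_n)\to0$. Moreover, for every such sequence $(K_n)$ and every choice of homeomorphisms $h_n:K_n\to K$, put $A_n=\{f\circ h_n: f\in A\}$ and $\tilde A=\{f\in C(X): f|_{K_n}\in A_n\text{ for all }n\}$. Then $\tilde A$ is an essential uniform algebra on $X$, the equality $\{f|_{K_n}: f\in\tilde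 A\}=A_n$ holds for all $n$, and: (i) $\tilde A$ is natural if and only if $A$ is natural; (ii) $\tilde A$ is regular on $X$ if and only if $A$ is regular on $K$; (iii) $\tilde A$ is normal if and only if $A$ is normal; (iv) every point of $X$ is a peak point for $\tilde A$ if and only if every point of $K$ is a peak point for $A$; (v) $\tilde A$ has bounded relative units if and only if $A$ has bounded relative units; (vi) $\tilde A$ is strongly regular if and only if $A$ is strongly regular; (vii) $\tilde A$ is a Ditkin algebra if and only if $A$ is a Ditkin algebra. Finally, at every point $x\in X\setminus\bigcup_n K_n$, $\tilde A$ has bounded relative units with bound $1$, $x$ is a peak point for $\tilde A$, $\tilde A$ satisfies Ditkin's condition at $x$, and $\tilde A$ is strongly regular at $x$. -/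

import Mathlib

open Filter Topology

noncomputable section

namespace UniformAlg

section Properties

variable {X : Type*} [TopologicalSpace X] [CompactSpace X]

/-- A uniform algebra on `X`: a closed subalgebra of `C(X, ℂ)` (with the supremum norm) that contains
the constants (automatic for a `Subalgebra`) and separates the points of `X`. -/
structure IsUniformAlgebra (A : Subalgebra ℂ C(X, ℂ)) : Prop where
  isClosed : IsClosed (A : Set C(X, ℂ))
  separatesPoints : A.SeparatesPoints

/-- `E` is the essential set for `A`: the smallest closed set such that `A` contains every continuous
function vanishing on it. -/
def IsEssentialSet (A : Subalgebra ℂ C(X, ℂ)) (E : Set X) : Prop :=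
  IsLeast {F : Set X | IsClosed F ∧ ∀ f : C(X, ℂ), (∀ x ∈ F, f x = 0) → f ∈ A} E

/-- `A` is essential: its essential set is all of `X`. -/
def IsEssential (A : Subalgebra ℂ C(X, ℂ)) : Prop :=
  IsEssentialSet A Set.univ

/-- `A` is natural: every non-zero multiplicative linear functional on `A` is evaluation at a point. -/
def IsNatural (A : Subalgebra ℂ C(X, ℂ)) : Prop :=
  ∀ φ : A →ₙₐ[ℂ] ℂ, φ ≠ 0 → ∃ x : X, ∀ f : A, φ f = (f : C(X, ℂ)) x

/-- `A` is regular on `X`. -/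
def IsRegularOn (A : Subalgebra ℂ C(X, ℂ)) : Prop :=
  ∀ E : Set X, IsClosed E → ∀ x ∉ E, ∃ f ∈ A, f x = 1 ∧ ∀ y ∈ E, f y = 0

/-- `A` is normal on `X`. -/
def IsNormalOn (A : Subalgebra ℂ C(X, ℂ)) : Prop :=
  ∀ E F : Set X, IsClosed E → IsClosed F → Disjoint E F →
    ∃ f ∈ A, (∀ y ∈ E, f y = 0) ∧ ∀ y ∈ F, f y = 1

/-- `A` is normal: natural and normal on `X`. -/
def IsNormal (A : Subalgebra ℂ C(X, ℂ)) : Prop :=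
  IsNatural A ∧ IsNormalOn A

/-- `x` is a peak point for `A`. -/
def IsPeakPoint (A : Subalgebra ℂ C(X, ℂ)) (x : X) : Prop :=
  ∃ f ∈ A, f x = 1 ∧ ∀ y, y ≠ x → ‖f y‖ < 1

/-- The ideal `M_x` of functions in `A` vanishing at `x`. -/
def idealM (A : Subalgebra ℂ C(X, ℂ)) (x : X) : Set C(X, ℂ) :=
  {f | f ∈ A ∧ f x = 0}

/-- The ideal `J_x` of functions in `A` whose zero set is a neighborhood of `x`. -/
def idealJ (A : Subalgebra ℂ C(X, ℂ)) (x : X) : Set C(X, ℂ) :=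
  {f | f ∈ A ∧ f ⁻¹' {0} ∈ 𝓝 x}

/-- `A` is strongly regular at `x`: `J_x` is dense in `M_x`. -/
def IsStronglyRegularAt (A : Subalgebra ℂ C(X, ℂ)) (x : X) : Prop :=
  idealM A x ⊆ closure (idealJ A x)

/-- `A` is strongly regular. -/
def IsStronglyRegular (A : Subalgebra ℂ C(X, ℂ)) : Prop :=
  ∀ x, IsStronglyRegularAt A x

/-- `A` satisfies Ditkin's condition at `x`. -/
def IsDitkinAt (A : Subalgebra ℂ C(X, ℂ)) (x : X) : Prop :=
  ∀ f ∈ idealM A x, ∀ ε : ℝ, 0 < ε → ∃ g ∈ idealJ A x, ‖g * f - f‖ < ε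

/-- `A` is a Ditkin algebra. -/
def IsDitkin (A : Subalgebra ℂ C(X, ℂ)) : Prop :=
  ∀ x, IsDitkinAt A x

/-- `A` has bounded relative units at `x` with bound `C`. -/
def HasBRUAtWith (A : Subalgebra ℂ C(X, ℂ)) (x : X) (C : ℝ) : Prop :=
  ∀ F : Set X, IsCompact F → x ∉ F → ∃ f ∈ idealJ A x, ‖f‖ ≤ C ∧ ∀ y ∈ F, f y = 1

/-- `A` has bounded relative units: at each point, with some bound `C ≥ 1` which may depend on the
point. -/
def HasBRU (A : Subalgebra ℂ C(X, ℂ)) : Prop :=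
  ∀ x, ∃ C : ℝ, 1 ≤ C ∧ HasBRUAtWith A x C

end Properties

section Construction

variable {K : Type*} [TopologicalSpace K]

/-- For `h : S → K` a homeomorphism, the algebra `{f ∘ h : f ∈ A}` on `S`. -/
def transport {S : Type*} [TopologicalSpace S] (A : Subalgebra ℂ C(K, ℂ)) (h : S ≃ₜ K) :
    Subalgebra ℂ C(S, ℂ) :=
  A.map (ContinuousMap.compRightAlgHom ℂ ℂ (h : C(S, K)))

/-- The algebra of all `f ∈ C(X, ℂ)` with `f|K_n` in `A_n = {g ∘ h_n : g ∈ A}` for every `n`. -/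
def tilde {X : Type*} [TopologicalSpace X] (A : Subalgebra ℂ C(K, ℂ)) (Kn : ℕ → Set X)
    (h : ∀ n, Kn n ≃ₜ K) : Subalgebra ℂ C(X, ℂ) where
  carrier := {f | ∀ n, f.restrict (Kn n) ∈ transport A (h n)}
  mul_mem' hf hg n := (transport A (h n)).mul_mem (hf n) (hg n)
  add_mem' hf hg n := (transport A (h n)).add_mem (hf n) (hg n)
  algebraMap_mem' r n := (transport A (h n)).algebraMap_mem r

/-- A sequence of pairwise disjoint, nowhere dense subspaces of `X`, each homeomorphic to `K`, with
dense union and with diameters tending to `0`. -/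
structure IsCopySequence (K : Type*) [TopologicalSpace K] {X : Type*} [MetricSpace X]
    (Kn : ℕ → Set X) : Prop where
  disjoint : Pairwise fun m n => Disjoint (Kn m) (Kn n)
  nowhereDense : ∀ n, IsNowhereDense (Kn n)
  homeomorphic : ∀ n, Nonempty (Kn n ≃ₜ K)
  dense : Dense (⋃ n, Kn n)
  diam : Tendsto (fun n => Metric.diam (Kn n)) atTop (𝓝 0)

end Construction

end UniformAlg

end

/-! The diameters of the pairwise disjoint compact copies `Kn n` tend to zero, so only finitely many
copies exceed any given size. Hence the partition of `X` whose classes are the copies with index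
outside a chosen set `S`, together with the remaining single points, has closed saturations of
closed sets, and its quotient is compact Hausdorff (`IsCopySequence.exists_quotient`). Tietze and
Urysohn on the quotient, pulled back to `X`, produce functions constant on each collapsed copy. Such
a restriction lies in `A` because `A` contains the constants, so membership in `tilde A Kn h` has to
be checked only on the copies in `S`.

This gives the tools `exists_extension`, `exists_cutoff` and `exists_peak`. From them, a function of
`A` on one copy extends to `tilde A Kn h` without increase of norm (`exists_mem_tilde_comp_eq`), and
a function vanishing near a point within its copy can be made to vanish near that point in `X`
(`exists_cutoff_mem_idealJ`). Every pointwise property then passes between `A` and a copy, while at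
points off the copies it holds outright, since cut-offs with `S = ∅` are available there;
`forall_iff_of_copyMap` combines the two.

Normality uses that only finitely many copies meet both of two disjoint closed sets. For naturality,
a character of `tilde A Kn h` restricts to the continuous functions on the quotient collapsing all
copies, where it is evaluation at a point. It is thus carried by one fiber: a single point, or a
copy, on which it is a character of `A`. Essentiality holds because every non-empty open set
contains a whole copy. -/

noncomputable section

namespace UniformAlg

/-! ### Quotients collapsing a null family of disjoint compact sets -/

section Quotient

universe u

variable {K : Type*} [TopologicalSpace K] {X : Type u} [MetricSpace X] {Kn : ℕ → Set X}

/-- The image of a normal T₁ space under a continuous closed surjection is Hausdorff. -/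
theorem t2Space_of_isClosedMap {X Y : Type*} [TopologicalSpace X] [NormalSpace X] [T1Space X]
    [TopologicalSpace Y] {q : X → Y} (hq : Continuous q) (hs : Function.Surjective q)
    (hc : IsClosedMap q) : T2Space Y := by
  have hpt : ∀ y : Y, IsClosed ({y} : Set Y) := fun y => by
    obtain ⟨x, rfl⟩ := hs y
    simpa using hc _ (isClosed_singleton (x := x))
  refine ⟨fun y z hyz => ?_⟩
  obtain ⟨U, V, hU, hV, hyU, hzV, hUV⟩ := normal_separation ((hpt y).preimage hq)
    ((hpt z).preimage hq) (Disjoint.preimage q (by simpa using hyz))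
  refine ⟨(q '' Uᶜ)ᶜ, (q '' Vᶜ)ᶜ, (hc _ hU.isClosed_compl).isOpen_compl,
    (hc _ hV.isClosed_compl).isOpen_compl, ?_, ?_, ?_⟩
  · rintro ⟨x, hx, rfl⟩
    exact hx (hyU rfl)
  · rintro ⟨x, hx, rfl⟩
    exact hx (hzV rfl)
  · rw [Set.disjoint_left]
    intro w hwU hwV
    obtain ⟨x, rfl⟩ := hs w
    have h1 : x ∈ U := by
      by_contra h
      exact hwU ⟨x, h, rfl⟩
    have h2 : x ∈ V := by
      by_contra h
      exact hwV ⟨x, h, rfl⟩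
    exact Set.disjoint_left.1 hUV h1 h2

theorem IsCopySequence.isCompact [CompactSpace K] (hK : IsCopySequence K Kn) (n : ℕ) :
    IsCompact (Kn n) := by
  obtain ⟨e⟩ := hK.homeomorphic n
  have := e.symm.compactSpace
  exact isCompact_iff_compactSpace.2 this

theorem IsCopySequence.isClosed [CompactSpace K] (hK : IsCopySequence K Kn) (n : ℕ) :
    IsClosed (Kn n) :=
  (hK.isCompact n).isClosed

theorem IsCopySequence.index_unique (hK : IsCopySequence K Kn) {m n : ℕ} {x : X}
    (hm : x ∈ Kn m) (hn : x ∈ Kn n) : m = n := by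
  by_contra h
  exact Set.disjoint_left.1 (hK.disjoint h) hm hn

theorem IsCopySequence.finite_le_diam (hK : IsCopySequence K Kn) {ε : ℝ} (hε : 0 < ε) :
    {n | ε ≤ Metric.diam (Kn n)}.Finite := by
  have := hK.diam.eventually (gt_mem_nhds hε)
  rw [← Nat.cofinite_eq_atTop] at this
  simpa [Filter.eventually_cofinite] using this

/-- The finitely many copies of large diameter form a closed set with empty interior. Removing it
from a small ball inside `U` leaves a non-empty open set, which by density meets a copy; that copy
is too small to leave `U`. -/
theorem IsCopySequence.exists_subset_of_isOpen [CompactSpace K] (hK : IsCopySequence K Kn) {U : Set X}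
    (hU : IsOpen U) (hne : U.Nonempty) : ∃ n, Kn n ⊆ U := by
  obtain ⟨p, hp⟩ := hne
  obtain ⟨ε, hε, hball⟩ := Metric.isOpen_iff.1 hU p hp
  have hT := hK.finite_le_diam (half_pos hε)
  have hint : interior (⋃ n ∈ {n | ε / 2 ≤ Metric.diam (Kn n)}, Kn n) = ∅ := by
    refine hT.induction_on_subset _ ?_ ?_
    · simp
    · intro n s _ hs _ ih
      rw [Set.biUnion_insert, interior_union_isClosed_of_interior_empty (hK.isClosed n) ih]
      exact (hK.isClosed n).isNowhereDense_iff.1 (hK.nowhereDense n)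
  have hV : IsOpen (Metric.ball p (ε / 2) \ ⋃ n ∈ {n | ε / 2 ≤ Metric.diam (Kn n)}, Kn n) :=
    Metric.isOpen_ball.sdiff (hT.isClosed_biUnion fun n _ => hK.isClosed n)
  have hVne : (Metric.ball p (ε / 2) \ ⋃ n ∈ {n | ε / 2 ≤ Metric.diam (Kn n)}, Kn n).Nonempty := by
    by_contra hcon
    rw [Set.not_nonempty_iff_eq_empty, Set.sdiff_eq_empty] at hcon
    have := interior_maximal hcon Metric.isOpen_ball (Metric.mem_ball_self (half_pos hε))
    rw [hint] at this
    exact this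
  obtain ⟨z, hz, ⟨hzp, hzT⟩⟩ := hK.dense.inter_open_nonempty _ hV hVne |>.imp fun z hz => hz.symm
  obtain ⟨n, hzn⟩ := Set.mem_iUnion.1 hz
  refine ⟨n, fun w hw => hball ?_⟩
  have h1 : Metric.diam (Kn n) < ε / 2 := by
    by_contra hcon
    exact hzT (Set.mem_biUnion (not_lt.1 hcon) hzn)
  have h2 := Metric.dist_le_diam_of_mem (hK.isCompact n).isBounded hw hzn
  have h3 := dist_triangle w z p
  rw [Metric.mem_ball] at hzp ⊢
  linarith

/-- The saturation of a closed set for the partition collapsing the sets `Kn n`, `n ∉ S`. -/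
theorem IsCopySequence.isClosed_saturation [CompactSpace K] (hK : IsCopySequence K Kn) (S : Set ℕ)
    {C : Set X} (hC : IsClosed C) :
    IsClosed {x | x ∈ C ∨ ∃ n ∉ S, x ∈ Kn n ∧ (Kn n ∩ C).Nonempty} := by
  rcases C.eq_empty_or_nonempty with rfl | hne
  · simp
  rw [← isOpen_compl_iff, isOpen_iff_mem_nhds]
  intro p hp
  simp only [Set.mem_compl_iff, Set.mem_ofPred_eq, not_or, not_exists, not_and] at hp
  have hd : 0 < Metric.infDist p C := (hC.notMem_iff_infDist_pos hne).1 hp.1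
  set d := Metric.infDist p C with hd_def
  -- A copy joining the ball of radius `d / 2` about `p` to `C` has diameter at least `d / 2`, so
  -- only the finitely many copies in `T` have to be avoided.
  let T := {n | d / 2 ≤ Metric.diam (Kn n)} ∩ {n | n ∉ S ∧ (Kn n ∩ C).Nonempty}
  have hT : T.Finite := (hK.finite_le_diam (half_pos hd)).inter_of_left _
  have hW : IsClosed (⋃ n ∈ T, Kn n) := hT.isClosed_biUnion fun n _ => hK.isClosed n
  have hpW : p ∉ ⋃ n ∈ T, Kn n := by
    simp only [Set.mem_iUnion, not_exists]
    exact fun n hn hpn => hp.2 n hn.2.1 hpn hn.2.2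
  filter_upwards [Metric.ball_mem_nhds p (half_pos hd), hW.isOpen_compl.mem_nhds hpW]
    with z hz hzW
  rintro (hzC | ⟨n, hnS, hzn, c, hcn, hcC⟩)
  · have := Metric.infDist_le_dist_of_mem (x := p) hzC
    rw [Metric.mem_ball, dist_comm] at hz
    linarith
  · have h1 : Metric.diam (Kn n) < d / 2 := by
      by_contra h
      exact hzW (Set.mem_biUnion (show n ∈ T from ⟨not_lt.1 h, hnS, c, hcn, hcC⟩) hzn)
    have h2 := Metric.dist_le_diam_of_mem (hK.isCompact n).isBounded hzn hcn
    have h3 := Metric.infDist_le_dist_of_mem (x := p) hcC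
    have h4 := dist_triangle p z c
    rw [Metric.mem_ball, dist_comm] at hz
    linarith

/-- The compact Hausdorff quotient of `X` collapsing each `Kn n`, `n ∉ S`, to a point. -/
theorem IsCopySequence.exists_quotient [CompactSpace K] [CompactSpace X]
    (hK : IsCopySequence K Kn) (S : Set ℕ) :
    ∃ (Y : Type u) (_ : TopologicalSpace Y) (_ : CompactSpace Y) (_ : T2Space Y) (q : C(X, Y)),
      Function.Surjective q ∧
        ∀ x y, q x = q y ↔ x = y ∨ ∃ n ∉ S, x ∈ Kn n ∧ y ∈ Kn n := by
  let r : Setoid X :=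
    { r := fun x y => x = y ∨ ∃ n ∉ S, x ∈ Kn n ∧ y ∈ Kn n
      iseqv :=
        { refl := fun x => Or.inl rfl
          symm := by
            rintro x y (rfl | ⟨n, hn, hx, hy⟩)
            · exact Or.inl rfl
            · exact Or.inr ⟨n, hn, hy, hx⟩
          trans := by
            rintro x y z (rfl | ⟨n, hn, hx, hy⟩) h
            · exact h
            rcases h with rfl | ⟨m, hm, hy', hz⟩
            · exact Or.inr ⟨n, hn, hx, hy⟩
            · obtain rfl := hK.index_unique hy hy'
              exact Or.inr ⟨n, hn, hx, hz⟩ } }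
  have hr : ∀ x y, (Quotient.mk r x = Quotient.mk r y) ↔
      (x = y ∨ ∃ n ∉ S, x ∈ Kn n ∧ y ∈ Kn n) := fun x y => Quotient.eq
  have hc : Continuous (Quotient.mk r) := continuous_quotient_mk'
  have hs : Function.Surjective (Quotient.mk r) := Quotient.mk_surjective
  have hcl : IsClosedMap (Quotient.mk r) := by
    intro C hC
    rw [← isQuotientMap_quotient_mk'.isClosed_preimage]
    convert hK.isClosed_saturation S hC using 1
    ext x
    simp only [Set.mem_preimage, Set.mem_image, Set.mem_ofPred_eq]
    constructor
    · rintro ⟨c, hc, hcx⟩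
      rcases (hr c x).1 hcx with rfl | ⟨n, hn, h1, h2⟩
      · exact Or.inl hc
      · exact Or.inr ⟨n, hn, h2, c, h1, hc⟩
    · rintro (hx | ⟨n, hn, hx, c, h1, h2⟩)
      · exact ⟨x, hx, rfl⟩
      · exact ⟨c, h2, (hr c x).2 (Or.inr ⟨n, hn, h1, hx⟩)⟩
  exact ⟨Quotient r, inferInstance, inferInstance, t2Space_of_isClosedMap hc hs hcl,
    ⟨_, hc⟩, hs, hr⟩

end Quotient

/-! ### Tietze, Urysohn and peak functions constant on the collapsed copies -/

section Extension

universe u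

variable {K : Type*} [TopologicalSpace K] [CompactSpace K] {X : Type u} [MetricSpace X]
  [CompactSpace X] {Kn : ℕ → Set X}

/-- Tietze extension by functions that are constant on `Kn n` for `n ∉ S`. -/
theorem IsCopySequence.exists_extension (hK : IsCopySequence K Kn) (S : Set ℕ) {E : Set X}
    (hE : IsClosed E) {g : X → ℂ} (hg : ContinuousOn g E)
    (hconst : ∀ n ∉ S, ∀ x ∈ Kn n ∩ E, ∀ y ∈ Kn n ∩ E, g x = g y)
    {C : ℝ} (hC : 0 ≤ C) (hgC : ∀ x ∈ E, ‖g x‖ ≤ C) :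
    ∃ f : C(X, ℂ), Set.EqOn f g E ∧ ‖f‖ ≤ C ∧ ∀ n ∉ S, ∀ x ∈ Kn n, ∀ y ∈ Kn n, f x = f y := by
  obtain ⟨Y, _, _, _, q, hqs, hq⟩ := hK.exists_quotient S
  have hqc : IsClosedMap q := q.continuous.isClosedMap
  have hgq : ∀ x ∈ E, ∀ y ∈ E, q x = q y → g x = g y := by
    intro x hx y hy hxy
    rcases (hq x y).1 hxy with rfl | ⟨n, hn, h1, h2⟩
    · rfl
    · exact hconst n hn x ⟨h1, hx⟩ y ⟨h2, hy⟩
  let e : q '' E → E := fun y => ⟨y.2.choose, y.2.choose_spec.1⟩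
  have he : ∀ y, q (e y) = y := fun y => y.2.choose_spec.2
  -- The section `e` need not be continuous. Continuity comes from `q` being closed: the preimage of
  -- a closed set is the trace of the `q`-image of a closed subset of `E`.
  have hcont : Continuous fun y : q '' E => g (e y) := by
    refine continuous_iff_isClosed.2 fun T hT => ?_
    obtain ⟨D, hD, hDE⟩ := continuousOn_iff_isClosed.1 hg T hT
    have : (fun y : q '' E => g (e y)) ⁻¹' T = Subtype.val ⁻¹' (q '' (D ∩ E)) := by
      rw [← hDE]
      ext ⟨y, hy⟩
      simp only [Set.mem_preimage, Set.mem_image, Set.mem_inter_iff]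
      constructor
      · intro h
        exact ⟨e ⟨y, hy⟩, ⟨h, (e ⟨y, hy⟩).2⟩, he ⟨y, hy⟩⟩
      · rintro ⟨x, ⟨hx, hxE⟩, rfl⟩
        rwa [hgq _ (e _).2 x hxE (he _)]
    rw [this]
    exact (hqc _ (hD.inter hE)).preimage continuous_subtype_val
  let g₀ : BoundedContinuousFunction (q '' E) ℂ :=
    BoundedContinuousFunction.ofNormedAddCommGroup _ hcont C fun y => hgC _ (e y).2
  have hg₀ : ‖g₀‖ ≤ C := BoundedContinuousFunction.norm_ofNormedAddCommGroup_le _ hC _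
  obtain ⟨F, hF, hFr⟩ := BoundedContinuousFunction.exists_norm_eq_domRestrict_eq (𝕜 := ℂ)
    (hqc _ hE) g₀
  refine ⟨F.toContinuousMap.comp q, ?_, ?_, ?_⟩
  · intro x hx
    have h1 := DFunLike.congr_fun hFr ⟨q x, x, hx, rfl⟩
    have h2 : F (q x) = g (e ⟨q x, x, hx, rfl⟩) := h1
    show F (q x) = g x
    rw [h2]
    exact hgq _ (e _).2 x hx (he _)
  · rw [ContinuousMap.norm_le _ hC]
    intro x
    exact (F.norm_coe_le_norm _).trans (hF.le.trans hg₀)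
  · intro n hn x hx y hy
    show F (q x) = F (q y)
    rw [(hq x y).2 (Or.inr ⟨n, hn, hx, hy⟩)]

/-- Urysohn functions that are constant on `Kn n` for `n ∉ S`. -/
theorem IsCopySequence.exists_cutoff (hK : IsCopySequence K Kn) (S : Set ℕ) {P D : Set X}
    (hP : IsClosed P) (hD : IsClosed D) (hPD : Disjoint P D)
    (hsat : ∀ n ∉ S, (Kn n ∩ P).Nonempty → Kn n ⊆ P) :
    ∃ k : C(X, ℝ), (∀ᶠ x in 𝓝ˢ P, k x = 0) ∧ (∀ x ∈ D, k x = 1) ∧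
      (∀ x, k x ∈ Set.Icc (0 : ℝ) 1) ∧ ∀ n ∉ S, ∀ x ∈ Kn n, ∀ y ∈ Kn n, k x = k y := by
  obtain ⟨Y, _, _, _, q, hqs, hq⟩ := hK.exists_quotient S
  have hqc : IsClosedMap q := q.continuous.isClosedMap
  have hdisj : Disjoint (q '' P) (q '' D) := by
    rw [Set.disjoint_left]
    rintro _ ⟨x, hx, rfl⟩ ⟨y, hy, hxy⟩
    rcases (hq y x).1 hxy with rfl | ⟨n, hn, h1, h2⟩
    · exact Set.disjoint_left.1 hPD hx hy
    · exact Set.disjoint_left.1 hPD (hsat n hn ⟨x, h2, hx⟩ h1) hy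
  obtain ⟨f, hf0, hf1, hf⟩ := exists_continuous_zero_one_of_isClosed (hqc _ hP) (hqc _ hD) hdisj
  -- The truncation makes the function vanish on the open set where `f ∘ q < 1 / 2`, a neighborhood
  -- of `P`, and not merely on `P`.
  refine ⟨⟨fun x => max 0 (2 * f (q x) - 1), by fun_prop⟩, ?_, ?_, ?_, ?_⟩
  · rw [eventually_nhdsSet_iff_exists]
    refine ⟨{x | f (q x) < 1 / 2}, isOpen_lt (by fun_prop) continuous_const, ?_, ?_⟩
    · intro x hx
      have := hf0 ⟨x, hx, rfl⟩
      simp only [Pi.zero_apply] at this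
      simp [this]
    · intro x hx
      simp only [Set.mem_ofPred_eq] at hx
      exact max_eq_left (by linarith)
  · intro x hx
    have := hf1 ⟨x, hx, rfl⟩
    simp only [Pi.one_apply] at this
    simp only [ContinuousMap.coe_mk, this]
    norm_num
  · intro x
    have := hf (q x)
    exact ⟨le_max_left _ _, max_le zero_le_one (by linarith [this.2])⟩
  · intro n hn x hx y hy
    simp only [ContinuousMap.coe_mk]
    rw [(hq x y).2 (Or.inr ⟨n, hn, hx, hy⟩)]

/-- Functions peaking on a closed saturated set that are constant on every `Kn n`, `n ∉ S`. -/
theorem IsCopySequence.exists_peak (hK : IsCopySequence K Kn) (S : Set ℕ) {P : Set X}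
    (hP : IsClosed P) (hsat : ∀ n ∉ S, (Kn n ∩ P).Nonempty → Kn n ⊆ P) :
    ∃ k : C(X, ℝ), (∀ x ∈ P, k x = 1) ∧ (∀ x ∉ P, k x < 1) ∧ (∀ x, 0 ≤ k x) ∧
      ∀ n ∉ S, ∀ x ∈ Kn n, ∀ y ∈ Kn n, k x = k y := by
  obtain ⟨Y, _, _, _, q, hqs, hq⟩ := hK.exists_quotient S
  have hqc : IsClosedMap q := q.continuous.isClosedMap
  have hqP : ∀ x, q x ∈ q '' P → x ∈ P := by
    rintro x ⟨y, hy, hxy⟩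
    rcases (hq y x).1 hxy with rfl | ⟨n, hn, h1, h2⟩
    · exact hy
    · exact hsat n hn ⟨y, h1, hy⟩ h2
  obtain ⟨U, hU, hPU⟩ := hP.isGδ.eq_iInter_nat
  -- `P` is a Gδ because `X` is metric. As `P` is saturated and `q` is closed, this passes to the
  -- image, so no metric on `Y` is needed.
  have hG : IsGδ (q '' P) := by
    have : q '' P = ⋂ n, (q '' (U n)ᶜ)ᶜ := by
      ext y
      obtain ⟨x, rfl⟩ := hqs y
      simp only [Set.mem_iInter, Set.mem_compl_iff]
      constructor
      · rintro hx n ⟨z, hz, hzx⟩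
        have : z ∈ P := hqP z (hzx ▸ hx)
        rw [hPU, Set.mem_iInter] at this
        exact hz (this n)
      · intro h
        refine ⟨x, ?_, rfl⟩
        rw [hPU, Set.mem_iInter]
        intro n
        by_contra hx
        exact h n ⟨x, hx, rfl⟩
    rw [this]
    exact .iInter_of_isOpen fun n => (hqc _ (hU n).isClosed_compl).isOpen_compl
  obtain ⟨f, hf1, -, -, hf⟩ := exists_continuous_one_zero_of_isCompact_of_isGδ
    (hqc _ hP).isCompact hG isClosed_empty (Set.disjoint_empty _)
  refine ⟨f.comp q, ?_, ?_, fun x => (hf (q x)).1, ?_⟩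
  · intro x hx
    have : q x ∈ f ⁻¹' {1} := hf1 ▸ ⟨x, hx, rfl⟩
    exact this
  · intro x hx
    refine lt_of_le_of_ne (hf (q x)).2 fun h => hx (hqP x ?_)
    rw [hf1]
    exact h
  · intro n hn x hx y hy
    simp only [ContinuousMap.comp_apply]
    rw [(hq x y).2 (Or.inr ⟨n, hn, hx, hy⟩)]

end Extension

/-! ### Existence of a copy sequence -/

section Existence

variable {K X : Type*} [TopologicalSpace K] [CompactSpace K] [Nonempty K]
  [MetricSpace X] [CompactSpace X] [Nonempty X]

/-- Run through a countable base. The copies chosen so far form a closed set with empty interior, so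
the next basic open set contains a small ball avoiding them, and a new copy is taken inside it. -/
theorem exists_isCopySequence
    (hX : ∀ U : Set X, IsOpen U → U.Nonempty →
      ∃ S : Set X, S ⊆ U ∧ IsNowhereDense S ∧ Nonempty (S ≃ₜ K)) :
    ∃ Kn : ℕ → Set X, IsCopySequence K Kn := by
  obtain ⟨b, hbc, hbe, hb⟩ := TopologicalSpace.exists_countable_basis X
  have hbne : b.Nonempty := by
    obtain ⟨x⟩ := ‹Nonempty X›
    obtain ⟨v, hv, -⟩ := hb.exists_subset_of_mem_open (Set.mem_univ x) isOpen_univ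
    exact ⟨v, hv⟩
  obtain ⟨B, rfl⟩ := hbc.exists_eq_range hbne
  have step : ∀ (n : ℕ) (C : Set X), IsClosed C → interior C = ∅ →
      ∃ T : Set X, T ⊆ B n ∧ Disjoint T C ∧ IsNowhereDense T ∧ Nonempty (T ≃ₜ K) ∧
        Metric.diam T ≤ 2 * (1 / ((n : ℝ) + 1)) := by
    intro n C hC hCi
    have hBo : IsOpen (B n) := hb.isOpen ⟨n, rfl⟩
    have hBn : (B n).Nonempty := by
      rw [Set.nonempty_iff_ne_empty]
      intro h
      exact hbe ⟨n, h⟩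
    have hne : (B n \ C).Nonempty := by
      by_contra h
      rw [Set.not_nonempty_iff_eq_empty, Set.sdiff_eq_empty] at h
      have := interior_maximal h hBo
      rw [hCi] at this
      exact hBn.ne_empty (Set.subset_empty_iff.1 this)
    obtain ⟨p, hpB, hpC⟩ := hne
    have hpos : (0 : ℝ) < 1 / ((n : ℝ) + 1) := by positivity
    obtain ⟨T, hT, hTn, hTK⟩ := hX ((B n ∩ Cᶜ) ∩ Metric.ball p (1 / ((n : ℝ) + 1)))
      ((hBo.inter hC.isOpen_compl).inter Metric.isOpen_ball)
      ⟨p, ⟨hpB, hpC⟩, Metric.mem_ball_self hpos⟩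
    refine ⟨T, fun x hx => (hT hx).1.1, ?_, hTn, hTK, ?_⟩
    · rw [Set.disjoint_left]
      exact fun x hx => (hT hx).1.2
    · exact (Metric.diam_mono (fun x hx => (hT hx).2) Metric.isBounded_ball).trans
        (Metric.diam_ball hpos.le)
  choose! G hG using step
  -- `C n` is the union of the copies with index below `n`; recursing on this union makes each new
  -- copy avoid all earlier ones.
  let C : ℕ → Set X := fun n => Nat.rec ∅ (fun m D => D ∪ G m D) n
  have hCs : ∀ n, C (n + 1) = C n ∪ G n (C n) := fun n => rfl
  have hC : ∀ n, IsClosed (C n) ∧ interior (C n) = ∅ := by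
    intro n
    induction n with
    | zero => exact ⟨isClosed_empty, interior_empty⟩
    | succ n ih =>
      obtain ⟨-, -, hn, ⟨e⟩, -⟩ := hG n (C n) ih.1 ih.2
      have := e.symm.compactSpace
      have hcl : IsClosed (G n (C n)) := (isCompact_iff_compactSpace.2 this).isClosed
      rw [hCs]
      refine ⟨ih.1.union hcl, ?_⟩
      rw [interior_union_isClosed_of_interior_empty ih.1 (hcl.isNowhereDense_iff.1 hn), ih.2]
  have hmono : Monotone C := monotone_nat_of_le_succ fun n => by
    rw [hCs]
    exact Set.subset_union_left
  have hlt : ∀ m n, m < n → Disjoint (G m (C m)) (G n (C n)) := by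
    intro m n hmn
    refine ((hG n (C n) (hC n).1 (hC n).2).2.1.mono_right ?_).symm
    refine Set.Subset.trans ?_ (hmono (Nat.succ_le_of_lt hmn))
    rw [hCs]
    exact Set.subset_union_right
  refine ⟨fun n => G n (C n), ?_, ?_, ?_, ?_, ?_⟩
  · intro m n hmn
    rcases lt_or_gt_of_ne hmn with h | h
    · exact hlt m n h
    · exact (hlt n m h).symm
  · exact fun n => (hG n (C n) (hC n).1 (hC n).2).2.2.1
  · exact fun n => (hG n (C n) (hC n).1 (hC n).2).2.2.2.1
  · rw [hb.dense_iff]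
    rintro _ ⟨n, rfl⟩ -
    obtain ⟨hB, -, -, ⟨e⟩, -⟩ := hG n (C n) (hC n).1 (hC n).2
    obtain ⟨k⟩ := ‹Nonempty K›
    exact ⟨(e.symm k).1, hB (e.symm k).2, Set.mem_iUnion.2 ⟨n, (e.symm k).2⟩⟩
  · refine squeeze_zero (fun n => Metric.diam_nonneg)
      (fun n => (hG n (C n) (hC n).1 (hC n).2).2.2.2.2) ?_
    simpa using tendsto_one_div_add_atTop_nhds_zero_nat.const_mul (2 : ℝ)

end Existence

/-! ### Copies of `K`, membership in the algebra, and multipliers -/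

section Copies

variable {K X : Type*} [TopologicalSpace K] [MetricSpace X] {Kn : ℕ → Set X}

/-- The embedding of `K` onto its `n`-th copy in `X`. -/
def copyMap (h : ∀ n, Kn n ≃ₜ K) (n : ℕ) : C(K, X) :=
  ⟨fun k => ((h n).symm k : X), continuous_subtype_val.comp (h n).symm.continuous⟩

theorem copyMap_mem (h : ∀ n, Kn n ≃ₜ K) (n : ℕ) (k : K) : copyMap h n k ∈ Kn n :=
  ((h n).symm k).2

theorem copyMap_apply (h : ∀ n, Kn n ≃ₜ K) (n : ℕ) (x : Kn n) : copyMap h n (h n x) = x := by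
  simp [copyMap]

theorem exists_copyMap_eq (h : ∀ n, Kn n ≃ₜ K) {n : ℕ} {x : X} (hx : x ∈ Kn n) :
    ∃ k, copyMap h n k = x :=
  ⟨h n ⟨x, hx⟩, copyMap_apply h n ⟨x, hx⟩⟩

theorem isEmbedding_copyMap (h : ∀ n, Kn n ≃ₜ K) (n : ℕ) : IsEmbedding (copyMap h n) :=
  IsEmbedding.subtypeVal.comp (h n).symm.isEmbedding

theorem isClosedEmbedding_copyMap [CompactSpace K] (h : ∀ n, Kn n ≃ₜ K) (n : ℕ) :
    IsClosedEmbedding (copyMap h n) :=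
  ⟨isEmbedding_copyMap h n, (isCompact_range (copyMap h n).continuous).isClosed⟩

theorem exists_comp_copyMap_eq [CompactSpace K] (h : ∀ n, Kn n ≃ₜ K) (n : ℕ) (a : C(K, ℂ)) :
    ∃ f : C(X, ℂ), f.comp (copyMap h n) = a :=
  ContinuousMap.exists_extension (isClosedEmbedding_copyMap h n) a

/-- Saturation input for `exists_cutoff` and `exists_peak`: at a point of a copy that copy stays
uncollapsed. Points off the copies, and whole copies, are saturated even when everything is
collapsed, which gives the next two lemmas. -/
theorem IsCopySequence.subset_singleton_of_ne (hK : IsCopySequence K Kn) {n : ℕ} {x : X}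
    (hx : x ∈ Kn n) : ∀ m ∉ ({n} : Set ℕ), (Kn m ∩ {x}).Nonempty → Kn m ⊆ {x} := by
  rintro m hm ⟨y, hy, rfl⟩
  exact (hm (hK.index_unique hy hx)).elim

theorem subset_singleton_of_notMem_iUnion {X : Type*} {Kn : ℕ → Set X} {x : X}
    (hx : x ∉ ⋃ n, Kn n) : ∀ m ∉ (∅ : Set ℕ), (Kn m ∩ {x}).Nonempty → Kn m ⊆ {x} := by
  rintro m - ⟨y, hy, rfl⟩
  exact (hx (Set.mem_iUnion.2 ⟨m, hy⟩)).elim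

theorem IsCopySequence.subset_of_inter_nonempty (hK : IsCopySequence K Kn) (n : ℕ) :
    ∀ m ∉ (∅ : Set ℕ), (Kn m ∩ Kn n).Nonempty → Kn m ⊆ Kn n := by
  rintro m - ⟨y, hy, hy'⟩
  rw [hK.index_unique hy hy']

theorem mem_transport_iff {S : Type*} [TopologicalSpace S] (A : Subalgebra ℂ C(K, ℂ))
    (h : S ≃ₜ K) (g : C(S, ℂ)) :
    g ∈ transport A h ↔ g.comp (h.symm : C(K, S)) ∈ A := by
  constructor
  · rintro ⟨a, ha, rfl⟩
    convert! ha
    ext k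
    simp
  · intro hg
    refine ⟨_, hg, ?_⟩
    ext x
    simp

theorem mem_tilde_iff {A : Subalgebra ℂ C(K, ℂ)} {h : ∀ n, Kn n ≃ₜ K} {f : C(X, ℂ)} :
    f ∈ tilde A Kn h ↔ ∀ n, f.comp (copyMap h n) ∈ A :=
  forall_congr' fun n => mem_transport_iff A (h n) _

/-- Restriction to the `n`-th copy of `K`. -/
def restrictHom (A : Subalgebra ℂ C(K, ℂ)) (h : ∀ n, Kn n ≃ₜ K) (n : ℕ) :
    tilde A Kn h →ₐ[ℂ] A :=
  AlgHom.codRestrict ((ContinuousMap.compRightAlgHom ℂ ℂ (copyMap h n)).comp (tilde A Kn h).val) A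
    fun f => mem_tilde_iff.1 f.2 n

@[simp]
theorem restrictHom_apply (A : Subalgebra ℂ C(K, ℂ)) (h : ∀ n, Kn n ≃ₜ K) (n : ℕ)
    (f : tilde A Kn h) (k : K) :
    (restrictHom A h n f : C(K, ℂ)) k = (f : C(X, ℂ)) (copyMap h n k) := rfl

theorem mem_of_forall_eq (A : Subalgebra ℂ C(K, ℂ)) {f : C(K, ℂ)}
    (hf : ∀ x y, f x = f y) : f ∈ A := by
  rcases isEmpty_or_nonempty K with hK | ⟨⟨k⟩⟩
  · convert! A.zero_mem
    ext x
    exact hK.elim x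
  · convert! A.algebraMap_mem (f k)
    ext x
    exact hf x k

/-- A real-valued continuous function regarded as a complex-valued one. -/
def complexify {X : Type*} [TopologicalSpace X] (k : C(X, ℝ)) : C(X, ℂ) :=
  ⟨fun x => (k x : ℂ), Complex.continuous_ofReal.comp k.continuous⟩

@[simp]
theorem complexify_apply {X : Type*} [TopologicalSpace X] (k : C(X, ℝ)) (x : X) :
    complexify k x = (k x : ℂ) := rfl

/-- Multiplication by `k` preserves `f ∈ tilde A Kn h` if on each copy `k` is constant or equal to
`1` where `f` does not vanish. -/
theorem complexify_mul_mem {A : Subalgebra ℂ C(K, ℂ)} {h : ∀ n, Kn n ≃ₜ K} {S : Set ℕ}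
    {k : C(X, ℝ)} {f : C(X, ℂ)} (hf : f ∈ tilde A Kn h)
    (hk : ∀ n ∉ S, ∀ x ∈ Kn n, ∀ y ∈ Kn n, k x = k y)
    (hk' : ∀ n ∈ S, ∀ x ∈ Kn n, f x ≠ 0 → k x = 1) : complexify k * f ∈ tilde A Kn h := by
  rw [mem_tilde_iff] at hf ⊢
  intro n
  by_cases hn : n ∈ S
  · convert! hf n using 1
    ext x
    by_cases h0 : f (copyMap h n x) = 0
    · simp [h0]
    · simp [hk' n hn _ (copyMap_mem h n x) h0]
  · have h1 : (complexify k).comp (copyMap h n) ∈ A := mem_of_forall_eq A fun x y => by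
      simp [hk n hn _ (copyMap_mem h n x) _ (copyMap_mem h n y)]
    exact A.mul_mem h1 (hf n)

theorem complexify_mem {A : Subalgebra ℂ C(K, ℂ)} {h : ∀ n, Kn n ≃ₜ K}
    {k : C(X, ℝ)} (hk : ∀ n ∉ (∅ : Set ℕ), ∀ x ∈ Kn n, ∀ y ∈ Kn n, k x = k y) :
    complexify k ∈ tilde A Kn h := by
  simpa using complexify_mul_mem (tilde A Kn h).one_mem hk (by simp)

theorem norm_complexify_mul_apply_le {X : Type*} [TopologicalSpace X] {k : C(X, ℝ)}
    (hk : ∀ x, k x ∈ Set.Icc (0 : ℝ) 1) (f : C(X, ℂ)) (x : X) :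
    ‖(complexify k * f) x‖ ≤ ‖f x‖ := by
  have := hk x
  simp only [ContinuousMap.mul_apply, complexify_apply, norm_mul, Complex.norm_real,
    Real.norm_eq_abs, abs_of_nonneg this.1]
  exact mul_le_of_le_one_left (norm_nonneg _) this.2

/-- The cut-off changes `f` only where `f` is already small, and there by a factor `k - 1` of
modulus at most one. This estimate drives the strong regularity, Ditkin and naturality arguments. -/
theorem norm_complexify_mul_sub_le {X : Type*} [TopologicalSpace X] [CompactSpace X] {k : C(X, ℝ)}
    (hk : ∀ x, k x ∈ Set.Icc (0 : ℝ) 1) {f : C(X, ℂ)} {ε : ℝ} (hε : 0 ≤ ε)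
    (hf : ∀ x, ε ≤ ‖f x‖ → k x = 1) : ‖complexify k * f - f‖ ≤ ε := by
  rw [ContinuousMap.norm_le _ hε]
  intro x
  by_cases hx : ε ≤ ‖f x‖
  · simpa [hf x hx] using hε
  · have h1 : (complexify k * f - f) x = ((k x - 1 : ℝ) : ℂ) * f x := by
      simp [sub_mul]
    rw [h1, norm_mul, Complex.norm_real, Real.norm_eq_abs, abs_sub_comm,
      abs_of_nonneg (by linarith [(hk x).2])]
    exact (mul_le_of_le_one_left (norm_nonneg _) (by linarith [(hk x).1])).trans (not_le.1 hx).le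

end Copies

/-! ### Extension from a copy, and the uniform algebra axioms -/

section Transfer

variable {K X : Type*} [TopologicalSpace K] [CompactSpace K] [MetricSpace X] [CompactSpace X]
  {Kn : ℕ → Set X} {A : Subalgebra ℂ C(K, ℂ)} (h : ∀ n, Kn n ≃ₜ K)

/-- On copies in `S` the extension is the prescribed member of `A`; on all others it is constant,
hence in `A`. -/
theorem IsCopySequence.exists_mem_tilde (hK : IsCopySequence K Kn) (S : Set ℕ) {E : Set X}
    (hE : IsClosed E) {g : X → ℂ} (hg : ContinuousOn g E)
    (hconst : ∀ n ∉ S, ∀ x ∈ Kn n ∩ E, ∀ y ∈ Kn n ∩ E, g x = g y)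
    (hS : ∀ n ∈ S, Kn n ⊆ E ∧ ∃ a ∈ A, ∀ k, g (copyMap h n k) = a k)
    {C : ℝ} (hC : 0 ≤ C) (hgC : ∀ x ∈ E, ‖g x‖ ≤ C) :
    ∃ f ∈ tilde A Kn h, Set.EqOn f g E ∧ ‖f‖ ≤ C := by
  obtain ⟨f, hfg, hfC, hf⟩ := hK.exists_extension S hE hg hconst hC hgC
  refine ⟨f, mem_tilde_iff.2 fun n => ?_, hfg, hfC⟩
  by_cases hn : n ∈ S
  · obtain ⟨hnE, a, ha, hag⟩ := hS n hn
    convert! ha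
    ext k
    exact (hfg (hnE (copyMap_mem h n k))).trans (hag k)
  · exact mem_of_forall_eq A fun x y => hf n hn _ (copyMap_mem h n x) _ (copyMap_mem h n y)

/-- A function of `A`, placed on the `n`-th copy, extends to `tilde A Kn h` with a constant value
prescribed on a closed set where it is compatible. -/
theorem IsCopySequence.exists_mem_tilde_comp_eq (hK : IsCopySequence K Kn) (n : ℕ) {a : C(K, ℂ)}
    (ha : a ∈ A) {F : Set X} (hF : IsClosed F) (c : ℂ) (hc : ∀ k, copyMap h n k ∈ F → a k = c)
    {C : ℝ} (haC : ‖a‖ ≤ C) (hcC : ‖c‖ ≤ C) :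
    ∃ f ∈ tilde A Kn h, f.comp (copyMap h n) = a ∧ (∀ x ∈ F, f x = c) ∧ ‖f‖ ≤ C := by
  classical
  obtain ⟨b, rfl⟩ := exists_comp_copyMap_eq h n a
  let g : X → ℂ := (Kn n).piecewise b fun _ => c
  have hgK : ∀ x ∈ Kn n, g x = b x := fun x hx => Set.piecewise_eq_of_mem _ _ _ hx
  have hgF : ∀ x ∈ F, g x = c := by
    intro x hx
    by_cases hxn : x ∈ Kn n
    · obtain ⟨k, rfl⟩ := exists_copyMap_eq h hxn
      rw [hgK _ hxn]
      exact hc k hx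
    · exact Set.piecewise_eq_of_notMem _ _ _ hxn
  have hcont : ContinuousOn g (Kn n ∪ F) :=
    (b.continuous.continuousOn.congr hgK).union_of_isClosed
      (continuousOn_const.congr hgF) (hK.isClosed n) hF
  obtain ⟨f, hf, hfg, hfC⟩ := hK.exists_mem_tilde (A := A) h {n} ((hK.isClosed n).union hF) hcont
    (C := C) (by
      intro m hm x hx y hy
      have hF' : ∀ z ∈ Kn m ∩ (Kn n ∪ F), z ∈ F := by
        rintro z ⟨hz, hzn | hzF⟩
        · exact (hm (hK.index_unique hz hzn)).elim
        · exact hzF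
      rw [hgF x (hF' x hx), hgF y (hF' y hy)])
    (by
      rintro m rfl
      exact ⟨Set.subset_union_left, _, ha, fun k => hgK _ (copyMap_mem h m k)⟩)
    ((norm_nonneg _).trans hcC)
    (by
      rintro x (hx | hx)
      · obtain ⟨k, rfl⟩ := exists_copyMap_eq h hx
        rw [hgK _ hx]
        exact ((b.comp (copyMap h n)).norm_coe_le_norm k).trans haC
      · rwa [hgF x hx])
  refine ⟨f, hf, ?_, fun x hx => (hfg (Or.inr hx)).trans (hgF x hx), hfC⟩
  ext k
  exact (hfg (Or.inl (copyMap_mem h n k))).trans (hgK _ (copyMap_mem h n k))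

theorem IsCopySequence.exists_mem_tilde_comp_eq_norm_le (hK : IsCopySequence K Kn) (n : ℕ)
    {a : C(K, ℂ)} (ha : a ∈ A) :
    ∃ f ∈ tilde A Kn h, f.comp (copyMap h n) = a ∧ ‖f‖ ≤ ‖a‖ := by
  obtain ⟨f, hf, hfa, -, hfC⟩ := hK.exists_mem_tilde_comp_eq h n ha isClosed_empty 0
    (by simp) le_rfl (by simp)
  exact ⟨f, hf, hfa, hfC⟩

theorem IsCopySequence.restrictHom_surjective (hK : IsCopySequence K Kn) (n : ℕ) :
    Function.Surjective (restrictHom A h n) := by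
  rintro ⟨a, ha⟩
  obtain ⟨f, hf, hfa, -⟩ := hK.exists_mem_tilde_comp_eq_norm_le h n ha
  exact ⟨⟨f, hf⟩, Subtype.ext hfa⟩

theorem IsCopySequence.restrict_image_tilde (hK : IsCopySequence K Kn) (n : ℕ) :
    (fun f : C(X, ℂ) => f.restrict (Kn n)) '' (tilde A Kn h : Set C(X, ℂ)) =
      (transport A (h n) : Set C(Kn n, ℂ)) := by
  ext g
  constructor
  · rintro ⟨f, hf, rfl⟩
    exact hf n
  · rintro ⟨a, ha, rfl⟩
    obtain ⟨f, hf, rfl, -⟩ := hK.exists_mem_tilde_comp_eq_norm_le h n ha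
    refine ⟨f, hf, ?_⟩
    ext x
    simp [copyMap_apply]

theorem isUniformAlgebra_tilde (hK : IsCopySequence K Kn) (hA : IsUniformAlgebra A) :
    IsUniformAlgebra (tilde A Kn h) := by
  constructor
  · have : (tilde A Kn h : Set C(X, ℂ)) =
        ⋂ n, (fun f : C(X, ℂ) => f.comp (copyMap h n)) ⁻¹' (A : Set C(K, ℂ)) := by
      ext f
      simp [mem_tilde_iff]
    rw [this]
    exact isClosed_iInter fun n => hA.isClosed.preimage (ContinuousMap.continuous_precomp _)
  · intro x y hxy
    by_cases hn : ∃ n, x ∈ Kn n ∧ y ∈ Kn n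
    · obtain ⟨n, hx, hy⟩ := hn
      obtain ⟨k, rfl⟩ := exists_copyMap_eq h hx
      obtain ⟨l, rfl⟩ := exists_copyMap_eq h hy
      obtain ⟨_, ⟨a, ha, rfl⟩, hakl⟩ := hA.separatesPoints (fun hkl : k = l => hxy (hkl ▸ rfl))
      obtain ⟨f, hf, rfl, -⟩ := hK.exists_mem_tilde_comp_eq_norm_le h n ha
      exact ⟨_, ⟨f, hf, rfl⟩, hakl⟩
    · classical
      push Not at hn
      -- No copy contains both points, so with every copy collapsed two different values can still
      -- be prescribed.
      obtain ⟨f, hf, hfg, -⟩ := hK.exists_mem_tilde (A := A) h ∅ (E := {x, y})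
        (Set.toFinite _).isClosed (g := fun z => if z = x then 1 else 0)
        ((Set.toFinite _).continuousOn _)
        (by
          rintro n - z ⟨hz, rfl | rfl⟩ w ⟨hw, rfl | rfl⟩
          · rfl
          · exact (hn n hz hw).elim
          · exact (hn n hw hz).elim
          · rfl) (by simp) zero_le_one
        (by
          intro z hz
          split_ifs <;> simp)
      refine ⟨_, ⟨f, hf, rfl⟩, ?_⟩
      have h1 := hfg (show x ∈ ({x, y} : Set X) by simp)
      have h2 := hfg (show y ∈ ({x, y} : Set X) by simp)
      simp only [if_true, if_neg hxy.symm] at h1 h2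
      simp [h1, h2]

end Transfer

/-- If a proper closed `F` were admissible, some copy would miss it. Any continuous function on that
copy extends to one vanishing on `F`, so all of `C(K, ℂ)` would lie in `A`. -/
theorem isEssential_tilde {K X : Type*} [TopologicalSpace K] [CompactSpace K] [MetricSpace X]
    {Kn : ℕ → Set X} {A : Subalgebra ℂ C(K, ℂ)} (h : ∀ n, Kn n ≃ₜ K) (hK : IsCopySequence K Kn)
    (hA : A ≠ ⊤) : IsEssential (tilde A Kn h) := by
  refine ⟨⟨isClosed_univ, fun f hf => ?_⟩, ?_⟩
  · convert! (tilde A Kn h).zero_mem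
    ext x
    exact hf x trivial
  · rintro F ⟨hF, hFA⟩ x -
    by_contra hx
    obtain ⟨n, hn⟩ := hK.exists_subset_of_isOpen hF.isOpen_compl ⟨x, hx⟩
    refine hA (eq_top_iff.2 fun a _ => ?_)
    obtain ⟨b, rfl⟩ := exists_comp_copyMap_eq h n a
    obtain ⟨k, hk0, hk1, -⟩ := exists_continuous_zero_one_of_isClosed hF (hK.isClosed n)
      (Set.disjoint_left.2 fun y hyF hyn => hn hyn hyF)
    have := mem_tilde_iff.1 (hFA (complexify k * b) fun y hy => by simp [hk0 hy]) n
    convert! this using 1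
    ext y
    simp [hk1 (copyMap_mem h n y)]

theorem apply_eq_zero_of_mem_idealJ {X : Type*} [TopologicalSpace X] [CompactSpace X]
    {B : Subalgebra ℂ C(X, ℂ)} {x : X} {f : C(X, ℂ)} (hf : f ∈ idealJ B x) : f x = 0 :=
  Set.mem_singleton_iff.1 (Set.mem_preimage.1 (mem_of_mem_nhds hf.2))

theorem comp_copyMap_mem_idealJ {K X : Type*} [TopologicalSpace K] [MetricSpace X] {Kn : ℕ → Set X}
    {A : Subalgebra ℂ C(K, ℂ)} (h : ∀ n, Kn n ≃ₜ K) {n : ℕ} {k : K} {f : C(X, ℂ)}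
    (hf : f ∈ idealJ (tilde A Kn h) (copyMap h n k)) : f.comp (copyMap h n) ∈ idealJ A k :=
  ⟨mem_tilde_iff.1 hf.1 n, (copyMap h n).continuous.continuousAt.preimage_mem_nhds hf.2⟩

/-! ### Cutting off near a point -/

section Localization

variable {K X : Type*} [TopologicalSpace K] [CompactSpace K] [MetricSpace X] [CompactSpace X]
  {Kn : ℕ → Set X} {A : Subalgebra ℂ C(K, ℂ)} (h : ∀ n, Kn n ≃ₜ K)

/-- A function in `tilde A Kn h` whose restriction to a copy vanishes near a point of this copy can
be cut off near that point. -/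
theorem IsCopySequence.exists_cutoff_mem_idealJ (hK : IsCopySequence K Kn) {n : ℕ} {k : K}
    {f : C(X, ℂ)} (hf : f ∈ tilde A Kn h) (hfJ : f.comp (copyMap h n) ∈ idealJ A k) {D : Set X}
    (hD : IsClosed D) (hkD : copyMap h n k ∉ D) :
    ∃ u : C(X, ℝ), (∀ x ∈ D, u x = 1) ∧ (∀ x, u x ∈ Set.Icc (0 : ℝ) 1) ∧
      complexify u * f ∈ idealJ (tilde A Kn h) (copyMap h n k) := by
  -- `V` cuts out of the copy the interior of the zero set of `f` there. Requiring `u = 1` on the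
  -- rest of the copy makes `u * f` agree with `f` on the copy, which keeps the product in the
  -- algebra.
  obtain ⟨V, hVo, hV⟩ := (isEmbedding_copyMap h n).isOpen_iff.1
    (isOpen_interior (s := f.comp (copyMap h n) ⁻¹' {0}))
  have hkV : copyMap h n k ∈ V := by
    have : k ∈ copyMap h n ⁻¹' V := by
      rw [hV]
      exact mem_interior_iff_mem_nhds.2 hfJ.2
    exact this
  obtain ⟨u, hu0, hu1, hu, hconst⟩ := hK.exists_cutoff {n} (isClosed_singleton (x := copyMap h n k))
    (hD.union ((hK.isClosed n).inter hVo.isClosed_compl))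
    (by
      rw [Set.disjoint_singleton_left]
      rintro (hk | hk)
      · exact hkD hk
      · exact hk.2 hkV)
    (hK.subset_singleton_of_ne (copyMap_mem h n k))
  refine ⟨u, fun x hx => hu1 x (Or.inl hx), hu, complexify_mul_mem hf hconst ?_, ?_⟩
  · rintro _ rfl x hx hfx
    refine hu1 x (Or.inr ⟨hx, fun hxV => hfx ?_⟩)
    obtain ⟨l, rfl⟩ := exists_copyMap_eq h hx
    have : l ∈ copyMap h _ ⁻¹' V := hxV
    rw [hV] at this
    exact Set.mem_singleton_iff.1 (Set.mem_preimage.1 (interior_subset this :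
      l ∈ f.comp (copyMap h _) ⁻¹' {0}))
  · rw [nhdsSet_singleton] at hu0
    filter_upwards [hu0] with x hx
    simp [hx]

/-- Cut-off functions near points outside of the copies. -/
theorem IsCopySequence.exists_complexify_mem_idealJ (hK : IsCopySequence K Kn) {x : X}
    (hx : x ∉ ⋃ n, Kn n) {D : Set X} (hD : IsClosed D) (hxD : x ∉ D) :
    ∃ u : C(X, ℝ), (∀ x ∈ D, u x = 1) ∧ (∀ x, u x ∈ Set.Icc (0 : ℝ) 1) ∧
      complexify u ∈ idealJ (tilde A Kn h) x := by
  obtain ⟨u, hu0, hu1, hu, hconst⟩ := hK.exists_cutoff ∅ (isClosed_singleton (x := x)) hD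
    (Set.disjoint_singleton_left.2 hxD) (subset_singleton_of_notMem_iUnion hx)
  refine ⟨u, hu1, hu, complexify_mem hconst, ?_⟩
  rw [nhdsSet_singleton] at hu0
  filter_upwards [hu0] with x hx
  simp [hx]

theorem isClosed_le_norm {X : Type*} [TopologicalSpace X] (f : C(X, ℂ)) (ε : ℝ) :
    IsClosed {x | ε ≤ ‖f x‖} :=
  isClosed_le continuous_const f.continuous.norm

theorem norm_comp_copyMap_le (f : C(X, ℂ)) (n : ℕ) : ‖f.comp (copyMap h n)‖ ≤ ‖f‖ := by
  rw [ContinuousMap.norm_le _ (norm_nonneg _)]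
  exact fun k => f.norm_coe_le_norm _

end Localization

/-! ### Points off the copies -/

section PointOutside

variable {K X : Type*} [TopologicalSpace K] [CompactSpace K] [MetricSpace X] [CompactSpace X]
  {Kn : ℕ → Set X} {A : Subalgebra ℂ C(K, ℂ)} (h : ∀ n, Kn n ≃ₜ K)

theorem hasBRUAtWith_one_of_notMem_iUnion (hK : IsCopySequence K Kn) {x : X}
    (hx : x ∉ ⋃ n, Kn n) : HasBRUAtWith (tilde A Kn h) x 1 := by
  intro F hF hxF
  obtain ⟨u, hu1, hu, huJ⟩ := hK.exists_complexify_mem_idealJ (A := A) h hx hF.isClosed hxF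
  refine ⟨_, huJ, ?_, fun y hy => by simp [hu1 y hy]⟩
  rw [ContinuousMap.norm_le _ zero_le_one]
  intro y
  simpa using norm_complexify_mul_apply_le hu 1 y

theorem isPeakPoint_of_notMem_iUnion (hK : IsCopySequence K Kn) {x : X}
    (hx : x ∉ ⋃ n, Kn n) : IsPeakPoint (tilde A Kn h) x := by
  obtain ⟨u, hu1, hu, hu0, hconst⟩ := hK.exists_peak ∅ (isClosed_singleton (x := x))
    (subset_singleton_of_notMem_iUnion hx)
  refine ⟨_, complexify_mem hconst, by simp [hu1 x rfl], fun y hy => ?_⟩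
  simpa [abs_of_nonneg (hu0 y)] using hu y hy

theorem isDitkinAt_of_notMem_iUnion (hK : IsCopySequence K Kn) {x : X}
    (hx : x ∉ ⋃ n, Kn n) : IsDitkinAt (tilde A Kn h) x := by
  intro f hf ε hε
  obtain ⟨u, hu1, hu, huJ⟩ := hK.exists_complexify_mem_idealJ (A := A) h hx
    (isClosed_le_norm f (ε / 2)) (by simp [hf.2, hε])
  exact ⟨_, huJ, (norm_complexify_mul_sub_le hu (half_pos hε).le hu1).trans_lt (half_lt_self hε)⟩

theorem IsDitkinAt.isStronglyRegularAt {X : Type*} [TopologicalSpace X] [CompactSpace X]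
    {B : Subalgebra ℂ C(X, ℂ)} {x : X} (hB : IsDitkinAt B x) : IsStronglyRegularAt B x := by
  intro f hf
  rw [Metric.mem_closure_iff]
  intro ε hε
  obtain ⟨g, hg, hgf⟩ := hB f hf ε hε
  refine ⟨g * f, ⟨B.mul_mem hg.1 hf.1, ?_⟩, by rwa [dist_comm, dist_eq_norm]⟩
  filter_upwards [hg.2] with y hy
  have : g y = 0 := hy
  simp [this]

end PointOutside

/-! ### Points on a copy -/

section PointInside

variable {K X : Type*} [TopologicalSpace K] [CompactSpace K] [MetricSpace X] [CompactSpace X]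
  {Kn : ℕ → Set X} {A : Subalgebra ℂ C(K, ℂ)} (h : ∀ n, Kn n ≃ₜ K)

/-- The bound is preserved exactly: the relative unit extends with value one on `F` and norm at most
`C`, and the later cut-off takes values in the unit interval. -/
theorem hasBRUAtWith_copyMap_iff (hK : IsCopySequence K Kn) {n : ℕ} {k : K} {C : ℝ} (hC : 1 ≤ C) :
    HasBRUAtWith (tilde A Kn h) (copyMap h n k) C ↔ HasBRUAtWith A k C := by
  constructor
  · intro H F hF hkF
    obtain ⟨f, hfJ, hfC, hf1⟩ := H (copyMap h n '' F) (hF.image (copyMap h n).continuous)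
      (by
        rintro ⟨l, hl, hlk⟩
        rw [(isEmbedding_copyMap h n).injective hlk] at hl
        exact hkF hl)
    exact ⟨_, comp_copyMap_mem_idealJ h hfJ, (norm_comp_copyMap_le h f n).trans hfC,
      fun y hy => hf1 _ ⟨y, hy, rfl⟩⟩
  · intro H F hF hkF
    obtain ⟨a, haJ, haC, ha1⟩ := H (copyMap h n ⁻¹' F)
      (hF.isClosed.preimage (copyMap h n).continuous).isCompact hkF
    obtain ⟨f, hf, rfl, hf1, hfC⟩ := hK.exists_mem_tilde_comp_eq h n haJ.1 hF.isClosed 1 ha1 haC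
      (by simpa using hC)
    obtain ⟨u, hu1, hu, huJ⟩ := hK.exists_cutoff_mem_idealJ h hf haJ hF.isClosed hkF
    refine ⟨_, huJ, ?_, fun y hy => by simp [hu1 y hy, hf1 y hy]⟩
    rw [ContinuousMap.norm_le _ (zero_le_one.trans hC)]
    intro y
    exact (norm_complexify_mul_apply_le hu f y).trans ((f.norm_coe_le_norm y).trans hfC)

theorem isStronglyRegularAt_copyMap_iff (hK : IsCopySequence K Kn) {n : ℕ} {k : K} :
    IsStronglyRegularAt (tilde A Kn h) (copyMap h n k) ↔ IsStronglyRegularAt A k := by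
  constructor
  · rintro H a ⟨ha, hak⟩
    obtain ⟨f, hf, rfl, -⟩ := hK.exists_mem_tilde_comp_eq_norm_le h n ha
    rw [Metric.mem_closure_iff]
    intro ε hε
    obtain ⟨g, hg, hfg⟩ := Metric.mem_closure_iff.1 (H ⟨hf, hak⟩) ε hε
    refine ⟨_, comp_copyMap_mem_idealJ h hg, ?_⟩
    rw [dist_eq_norm] at hfg ⊢
    exact (norm_comp_copyMap_le h (f - g) n).trans_lt hfg
  · rintro H f ⟨hf, hfk⟩
    rw [Metric.mem_closure_iff]
    intro ε hε
    obtain ⟨b, hb, hfb⟩ := Metric.mem_closure_iff.1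
      (H ⟨mem_tilde_iff.1 hf n, hfk⟩) (ε / 2) (half_pos hε)
    -- Extending the small error, rather than `b`, makes `f - v` restrict to `b` while staying
    -- within `ε / 2` of `f` on all of `X`.
    obtain ⟨v, hv, hvb, hvn⟩ := hK.exists_mem_tilde_comp_eq_norm_le h n
      (A.sub_mem (mem_tilde_iff.1 hf n) hb.1)
    have hcomp : (f - v).comp (copyMap h n) = b := by
      have : (f - v).comp (copyMap h n) = f.comp (copyMap h n) - v.comp (copyMap h n) := rfl
      rw [this, hvb, sub_sub_cancel]
    have hbk : (f - v) (copyMap h n k) = 0 := by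
      have h1 : b k = 0 := apply_eq_zero_of_mem_idealJ hb
      rw [← hcomp] at h1
      exact h1
    obtain ⟨u, hu1, hu, huJ⟩ := hK.exists_cutoff_mem_idealJ h ((tilde A Kn h).sub_mem hf hv)
      (hcomp ▸ hb) (isClosed_le_norm (f - v) (ε / 2)) (by
        rw [Set.mem_ofPred_eq, hbk, norm_zero, not_le]
        exact half_pos hε)
    refine ⟨_, huJ, ?_⟩
    have h1 := norm_complexify_mul_sub_le hu (half_pos hε).le hu1
    rw [dist_eq_norm] at hfb
    calc dist f (complexify u * (f - v))
        = ‖v - (complexify u * (f - v) - (f - v))‖ := by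
          rw [dist_eq_norm]
          congr 1
          abel
      _ ≤ ‖v‖ + ‖complexify u * (f - v) - (f - v)‖ := norm_sub_le _ _
      _ < ε / 2 + ε / 2 := add_lt_add_of_lt_of_le (hvn.trans_lt hfb) h1
      _ = ε := add_halves ε

theorem isDitkinAt_copyMap_iff (hK : IsCopySequence K Kn) {n : ℕ} {k : K} :
    IsDitkinAt (tilde A Kn h) (copyMap h n k) ↔ IsDitkinAt A k := by
  constructor
  · rintro H a ⟨ha, hak⟩ ε hε
    obtain ⟨f, hf, rfl, -⟩ := hK.exists_mem_tilde_comp_eq_norm_le h n ha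
    obtain ⟨g, hg, hgf⟩ := H f ⟨hf, hak⟩ ε hε
    exact ⟨_, comp_copyMap_mem_idealJ h hg, (norm_comp_copyMap_le h (g * f - f) n).trans_lt hgf⟩
  · rintro H f ⟨hf, hfk⟩ ε hε
    have hε3 : 0 < ε / 3 := by positivity
    obtain ⟨b, hb, hbf⟩ := H _ ⟨mem_tilde_iff.1 hf n, hfk⟩ (ε / 3) hε3
    obtain ⟨g, hg, rfl, -⟩ := hK.exists_mem_tilde_comp_eq_norm_le h n hb.1
    -- `w` is `1` on the copy and vanishes where `g * f - f` is not small
    obtain ⟨w, hw0, hw1, hw, hwc⟩ := hK.exists_cutoff ∅ (hK.isClosed n)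
      (isClosed_le_norm (g * f - f) (ε / 3))
      (by
        rw [Set.disjoint_left]
        intro x hx
        obtain ⟨l, rfl⟩ := exists_copyMap_eq h hx
        rw [Set.mem_ofPred_eq, not_le]
        exact (((g * f - f).comp (copyMap h n)).norm_coe_le_norm l).trans_lt hbf)
      (hK.subset_of_inter_nonempty n)
    -- The extension `g` is a good unit for `f` only near the copy. Since `g' * f - f = (1 - w) * (g
    -- * f - f)`, with `w` zero on the copy and one where the error is at least `ε / 3`, the new
    -- `g'` is a good unit everywhere and still restricts to the old one.
    let g' : C(X, ℂ) := g - complexify w * (g - 1)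
    have hg' : g' ∈ tilde A Kn h := (tilde A Kn h).sub_mem hg
      ((tilde A Kn h).mul_mem (complexify_mem hwc) ((tilde A Kn h).sub_mem hg (one_mem _)))
    have hcomp : g'.comp (copyMap h n) = g.comp (copyMap h n) := by
      ext l
      simp [g', (hw0.self_of_nhdsSet) _ (copyMap_mem h n l)]
    have hg'f : ‖g' * f - f‖ ≤ ε / 3 := by
      have h1 : g' * f - f = -(complexify w * (g * f - f) - (g * f - f)) := by
        simp only [g']
        ring
      rw [h1, norm_neg]
      exact norm_complexify_mul_sub_le hw hε3.le hw1
    obtain ⟨u, hu1, hu, huJ⟩ := hK.exists_cutoff_mem_idealJ h hg' (hcomp ▸ hb)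
      (isClosed_le_norm f (ε / 3)) (by
        rw [Set.mem_ofPred_eq, hfk, norm_zero, not_le]
        exact hε3)
    refine ⟨_, huJ, ?_⟩
    have h1 := norm_complexify_mul_sub_le hu hε3.le hu1
    have h2 : ‖complexify u * (g' * f - f)‖ ≤ ε / 3 := by
      rw [ContinuousMap.norm_le _ hε3.le]
      intro y
      exact (norm_complexify_mul_apply_le hu _ y).trans
        (((g' * f - f).norm_coe_le_norm y).trans hg'f)
    calc ‖complexify u * g' * f - f‖
        = ‖complexify u * (g' * f - f) + (complexify u * f - f)‖ := by
          congr 1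
          ring
      _ ≤ ‖complexify u * (g' * f - f)‖ + ‖complexify u * f - f‖ := norm_add_le _ _
      _ ≤ ε / 3 + ε / 3 := add_le_add h2 h1
      _ < ε := by linarith

theorem isPeakPoint_copyMap_iff (hK : IsCopySequence K Kn) {n : ℕ} {k : K} :
    IsPeakPoint (tilde A Kn h) (copyMap h n k) ↔ IsPeakPoint A k := by
  constructor
  · rintro ⟨f, hf, hfk, hf1⟩
    refine ⟨_, mem_tilde_iff.1 hf n, hfk, fun l hl => hf1 _ fun hlk => hl ?_⟩
    exact (isEmbedding_copyMap h n).injective hlk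
  · rintro ⟨a, ha, hak, ha1⟩
    have haC : ‖a‖ ≤ 1 := by
      rw [ContinuousMap.norm_le _ zero_le_one]
      intro l
      by_cases hl : l = k
      · simp [hl, hak]
      · exact (ha1 l hl).le
    obtain ⟨f, hf, rfl, hfn⟩ := hK.exists_mem_tilde_comp_eq_norm_le h n ha
    -- `u` peaks on the whole copy and `f` peaks at the point within it; as `‖f‖ ≤ 1`, the product
    -- peaks at the point in `X`.
    obtain ⟨u, hu1, hu, hu0, hconst⟩ := hK.exists_peak ∅ (hK.isClosed n)
      (hK.subset_of_inter_nonempty n)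
    refine ⟨complexify u * f, (tilde A Kn h).mul_mem (complexify_mem hconst) hf, ?_, ?_⟩
    · have : f (copyMap h n k) = 1 := hak
      simp [hu1 _ (copyMap_mem h n k), this]
    · intro y hy
      have hval : ‖(complexify u * f) y‖ = u y * ‖f y‖ := by
        simp [abs_of_nonneg (hu0 y)]
      rw [hval]
      by_cases hyn : y ∈ Kn n
      · obtain ⟨l, rfl⟩ := exists_copyMap_eq h hyn
        rw [hu1 _ hyn, one_mul]
        exact ha1 l fun hl => hy (hl ▸ rfl)
      · exact (mul_le_of_le_one_right (hu0 y)
          ((f.norm_coe_le_norm y).trans (hfn.trans haC))).trans_lt (hu y hyn)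

end PointInside

/-- A pointwise property that holds outside of the copies and transfers along the copies. -/
theorem forall_iff_of_copyMap {K X : Type*} [TopologicalSpace K] [MetricSpace X]
    {Kn : ℕ → Set X} (h : ∀ n, Kn n ≃ₜ K) {P : X → Prop} {Q : K → Prop}
    (hout : ∀ x ∉ ⋃ n, Kn n, P x) (hin : ∀ n k, P (copyMap h n k) ↔ Q k) : (∀ x, P x) ↔ ∀ k, Q k := by
  refine ⟨fun H k => (hin 0 k).1 (H _), fun H x => ?_⟩
  by_cases hx : x ∈ ⋃ n, Kn n
  · obtain ⟨n, hn⟩ := Set.mem_iUnion.1 hx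
    obtain ⟨k, rfl⟩ := exists_copyMap_eq h hn
    exact (hin n k).2 (H k)
  · exact hout x hx

/-! ### Regularity and normality -/

section Global

variable {K X : Type*} [TopologicalSpace K] [CompactSpace K] [MetricSpace X] [CompactSpace X]
  {Kn : ℕ → Set X} {A : Subalgebra ℂ C(K, ℂ)} (h : ∀ n, Kn n ≃ₜ K)

theorem isRegularOn_tilde_iff (hK : IsCopySequence K Kn) :
    IsRegularOn (tilde A Kn h) ↔ IsRegularOn A := by
  constructor
  · intro H E hE k hk
    obtain ⟨f, hf, hfk, hfE⟩ := H _ ((isClosedEmbedding_copyMap h 0).isClosedMap _ hE)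
      (copyMap h 0 k) (by
        rintro ⟨l, hl, hlk⟩
        rw [(isEmbedding_copyMap h 0).injective hlk] at hl
        exact hk hl)
    exact ⟨_, mem_tilde_iff.1 hf 0, hfk, fun l hl => hfE _ ⟨l, hl, rfl⟩⟩
  · intro H E hE x hxE
    by_cases hx : x ∈ ⋃ n, Kn n
    · obtain ⟨n, hn⟩ := Set.mem_iUnion.1 hx
      obtain ⟨k, rfl⟩ := exists_copyMap_eq h hn
      obtain ⟨a, ha, hak, haE⟩ := H _ (hE.preimage (copyMap h n).continuous) k hxE
      obtain ⟨f, hf, rfl, hfE, -⟩ := hK.exists_mem_tilde_comp_eq h n ha hE 0 haE le_rfl (by simp)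
      exact ⟨f, hf, hak, hfE⟩
    · obtain ⟨u, hu1, -, huJ⟩ := hK.exists_complexify_mem_idealJ (A := A) h hx hE hxE
      refine ⟨1 - complexify u, sub_mem (one_mem _) huJ.1, ?_, fun y hy => by simp [hu1 y hy]⟩
      have : complexify u x = 0 := apply_eq_zero_of_mem_idealJ huJ
      rw [ContinuousMap.sub_apply, this]
      simp

/-- Disjoint closed sets are both met by finitely many copies only. -/
theorem IsCopySequence.finite_inter_nonempty (hK : IsCopySequence K Kn) {E F : Set X}
    (hE : IsClosed E) (hF : IsClosed F) (hEF : Disjoint E F) :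
    {n | (Kn n ∩ E).Nonempty ∧ (Kn n ∩ F).Nonempty}.Finite := by
  obtain ⟨r, hr, hrEF⟩ := Metric.exists_pos_forall_lt_edist hE.isCompact hF hEF
  refine (hK.finite_le_diam (ε := r) (by exact_mod_cast hr)).subset ?_
  rintro n ⟨⟨x, hxn, hxE⟩, y, hyn, hyF⟩
  refine le_trans ?_ (Metric.dist_le_diam_of_mem (hK.isCompact n).isBounded hxn hyn)
  have := hrEF x hxE y hyF
  rw [edist_nndist] at this
  exact_mod_cast this.le

/-- Normality of `A` is needed only on the finitely many copies meeting both sets. Any other copy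
meets at most one of them, so the data there are constant and the copy can be collapsed. -/
theorem isNormalOn_tilde_iff (hK : IsCopySequence K Kn) :
    IsNormalOn (tilde A Kn h) ↔ IsNormalOn A := by
  classical
  constructor
  · intro H E F hE hF hEF
    obtain ⟨f, hf, hfE, hfF⟩ := H _ _ ((isClosedEmbedding_copyMap h 0).isClosedMap _ hE)
      ((isClosedEmbedding_copyMap h 0).isClosedMap _ hF)
      ((Set.disjoint_image_iff (isEmbedding_copyMap h 0).injective).2 hEF)
    exact ⟨_, mem_tilde_iff.1 hf 0, fun l hl => hfE _ ⟨l, hl, rfl⟩, fun l hl => hfF _ ⟨l, hl, rfl⟩⟩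
  · intro H E F hE hF hEF
    let S := {n | (Kn n ∩ E).Nonempty ∧ (Kn n ∩ F).Nonempty}
    have hS : S.Finite := hK.finite_inter_nonempty hE hF hEF
    have hex : ∀ n, ∃ b : C(X, ℂ), b.comp (copyMap h n) ∈ A ∧ (∀ x ∈ Kn n ∩ E, b x = 0) ∧
        ∀ x ∈ Kn n ∩ F, b x = 1 := by
      intro n
      obtain ⟨a, ha, haE, haF⟩ := H _ _ (hE.preimage (copyMap h n).continuous)
        (hF.preimage (copyMap h n).continuous) (hEF.preimage _)
      obtain ⟨b, rfl⟩ := exists_comp_copyMap_eq h n a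
      refine ⟨b, ha, ?_, ?_⟩
      · rintro x ⟨hx, hxE⟩
        obtain ⟨k, rfl⟩ := exists_copyMap_eq h hx
        exact haE k hxE
      · rintro x ⟨hx, hxF⟩
        obtain ⟨k, rfl⟩ := exists_copyMap_eq h hx
        exact haF k hxF
    choose b hbA hbE hbF using hex
    -- The choice of index is forced by disjointness. Off the copies in `S` only the values on `E ∪
    -- F` matter.
    let g : X → ℂ := fun x => if hx : ∃ n ∈ S, x ∈ Kn n then b hx.choose x else F.indicator 1 x
    have hgS : ∀ n ∈ S, ∀ x ∈ Kn n, g x = b n x := by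
      intro n hn x hx
      have hex : ∃ n ∈ S, x ∈ Kn n := ⟨n, hn, hx⟩
      have : g x = b hex.choose x := dif_pos hex
      rw [this, hK.index_unique hex.choose_spec.2 hx]
    have hgE : ∀ x ∈ E, g x = 0 := by
      intro x hx
      by_cases hex : ∃ n ∈ S, x ∈ Kn n
      · obtain ⟨n, hn, hxn⟩ := hex
        rw [hgS n hn x hxn, hbE n x ⟨hxn, hx⟩]
      · have : g x = F.indicator 1 x := dif_neg hex
        rw [this, Set.indicator_of_notMem (Set.disjoint_left.1 hEF hx)]
    have hgF : ∀ x ∈ F, g x = 1 := by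
      intro x hx
      by_cases hex : ∃ n ∈ S, x ∈ Kn n
      · obtain ⟨n, hn, hxn⟩ := hex
        rw [hgS n hn x hxn, hbF n x ⟨hxn, hx⟩]
      · have : g x = F.indicator 1 x := dif_neg hex
        rw [this, Set.indicator_of_mem hx, Pi.one_apply]
    have hcl : IsClosed (⋃ n : S, Kn n) := by
      have := hS.to_subtype
      exact isClosed_iUnion_of_finite fun n => hK.isClosed n
    have hcontS : ContinuousOn g (⋃ n : S, Kn n) := by
      have := hS.to_subtype
      exact (locallyFinite_of_finite _).continuousOn_iUnion (fun n => hK.isClosed n)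
        fun n => (b n).continuous.continuousOn.congr (hgS n n.2)
    have hclT : IsClosed ((⋃ n : S, Kn n) ∪ (E ∪ F)) := hcl.union (hE.union hF)
    have hcont : ContinuousOn g ((⋃ n : S, Kn n) ∪ (E ∪ F)) :=
      hcontS.union_of_isClosed ((continuousOn_const.congr hgE).union_of_isClosed
        (continuousOn_const.congr hgF) hE hF) hcl (hE.union hF)
    obtain ⟨C, hC⟩ := hclT.isCompact.exists_bound_of_continuousOn hcont
    obtain ⟨f, hf, hfg, -⟩ := hK.exists_mem_tilde (A := A) h S hclT hcont
      (by
        have hmem : ∀ n ∉ S, ∀ z ∈ Kn n ∩ ((⋃ n : S, Kn n) ∪ (E ∪ F)), z ∈ E ∪ F := by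
          rintro n hn z ⟨hz, hz' | hz'⟩
          · obtain ⟨m, hm⟩ := Set.mem_iUnion.1 hz'
            rw [hK.index_unique hz hm] at hn
            exact (hn m.2).elim
          · exact hz'
        intro n hn x hx y hy
        rcases hmem n hn x hx with hxE | hxF <;> rcases hmem n hn y hy with hyE | hyF
        · rw [hgE x hxE, hgE y hyE]
        · exact (hn ⟨⟨x, hx.1, hxE⟩, y, hy.1, hyF⟩).elim
        · exact (hn ⟨⟨y, hy.1, hyE⟩, x, hx.1, hxF⟩).elim
        · rw [hgF x hxF, hgF y hyF])
      (fun n hn => ⟨(Set.subset_iUnion (fun n : S => Kn n) ⟨n, hn⟩).trans Set.subset_union_left,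
        _, hbA n, fun k => hgS n hn _ (copyMap_mem h n k)⟩)
      (le_max_right C 0) (fun x hx => (hC x hx).trans (le_max_left _ _))
    exact ⟨f, hf, fun x hx => (hfg (Or.inr (Or.inl hx))).trans (hgE x hx),
      fun x hx => (hfg (Or.inr (Or.inr hx))).trans (hgF x hx)⟩

end Global

/-! ### Naturality -/

section Natural

universe u

variable {K : Type*} {X : Type u} [TopologicalSpace K] [CompactSpace K] [MetricSpace X]
  [CompactSpace X] {Kn : ℕ → Set X} {A : Subalgebra ℂ C(K, ℂ)} (h : ∀ n, Kn n ≃ₜ K)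

theorem isNatural_of_isNatural_tilde (hK : IsCopySequence K Kn)
    (H : IsNatural (tilde A Kn h)) : IsNatural A := by
  intro φ hφ
  let ψ : tilde A Kn h →ₙₐ[ℂ] ℂ := φ.comp (restrictHom A h 0 : tilde A Kn h →ₙₐ[ℂ] A)
  have hψ : ∀ f, ψ f = φ (restrictHom A h 0 f) := fun f => rfl
  have hsurj := hK.restrictHom_surjective (A := A) h 0
  obtain ⟨x, hx⟩ := H ψ (by
    intro h0
    refine hφ (NonUnitalAlgHom.ext fun a => ?_)
    obtain ⟨f, rfl⟩ := hsurj a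
    rw [← hψ, h0]
    rfl)
  -- Otherwise some function vanishes on the copy but is one at `x`, although `ψ` sees only the
  -- restriction to the copy.
  have hx0 : x ∈ Kn 0 := by
    by_contra hxn
    obtain ⟨f, hf, hf0, hfx, -⟩ := hK.exists_mem_tilde_comp_eq (A := A) h 0 A.zero_mem
      (isClosed_singleton (x := x)) 1 (by
        intro k hk
        rw [Set.mem_singleton_iff] at hk
        exact (hxn (hk ▸ copyMap_mem h 0 k)).elim) (C := 1) (by simp) (by simp)
    have h1 := hx ⟨f, hf⟩
    have h2 : restrictHom A h 0 ⟨f, hf⟩ = 0 := Subtype.ext hf0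
    rw [hψ, h2, map_zero] at h1
    exact zero_ne_one (h1.trans (hfx x rfl))
  obtain ⟨k, rfl⟩ := exists_copyMap_eq h hx0
  refine ⟨k, fun a => ?_⟩
  obtain ⟨f, rfl⟩ := hsurj a
  exact hx f

/-- A nonzero multiplicative linear functional on a unital algebra is unital. -/
theorem exists_algHom_of_ne_zero {B : Type*} [Ring B] [Algebra ℂ B] {φ : B →ₙₐ[ℂ] ℂ}
    (hφ : φ ≠ 0) : ∃ Φ : B →ₐ[ℂ] ℂ, ∀ b, Φ b = φ b := by
  have hone : φ 1 = 1 := by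
    by_contra h1
    have h0 : φ 1 = 0 := by
      have : φ 1 * φ 1 = φ 1 := by rw [← map_mul, one_mul]
      rcases mul_eq_zero.1 (show φ 1 * (φ 1 - 1) = 0 by rw [mul_sub, this, mul_one, sub_self]) with
        h0 | h0
      · exact h0
      · exact (h1 (sub_eq_zero.1 h0)).elim
    refine hφ (NonUnitalAlgHom.ext fun b => ?_)
    rw [← mul_one b, map_mul, h0, mul_zero]
    rfl
  exact ⟨AlgHom.ofLinearMap ⟨⟨φ, map_add φ⟩, map_smul φ⟩ hone (map_mul φ), fun _ => rfl⟩

/-- A homomorphism to `ℂ` vanishing on the kernel of a surjection factors through it. -/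
theorem exists_algHom_factor {B C : Type*} [Ring B] [Algebra ℂ B] [Ring C] [Algebra ℂ C]
    {R : B →ₐ[ℂ] C} (hR : Function.Surjective R) {Φ : B →ₐ[ℂ] ℂ}
    (hker : ∀ b, R b = 0 → Φ b = 0) : ∃ χ : C →ₐ[ℂ] ℂ, ∀ b, χ (R b) = Φ b :=
  ⟨(Ideal.Quotient.liftₐ (RingHom.ker R) Φ fun b hb => hker b hb).comp
    (Ideal.quotientKerAlgEquivOfSurjective hR).symm.toAlgHom, fun b => by
    have : (Ideal.quotientKerAlgEquivOfSurjective hR).symm (R b) =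
        Ideal.Quotient.mk (RingHom.ker R) b := by
      rw [AlgEquiv.symm_apply_eq]
      rfl
    simp only [AlgHom.comp_apply, AlgEquiv.coe_toAlgHom, this]
    rfl⟩

/-- A closed subalgebra is a Banach algebra, and characters of Banach algebras are contractive. -/
theorem norm_apply_le_of_isClosed {Z : Type*} [TopologicalSpace Z] [CompactSpace Z] [Nonempty Z]
    {B : Subalgebra ℂ C(Z, ℂ)} (hB : IsClosed (B : Set C(Z, ℂ))) (φ : B →ₐ[ℂ] ℂ) (f : B) :
    ‖φ f‖ ≤ ‖(f : C(Z, ℂ))‖ := by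
  have : CompleteSpace B := hB.completeSpace_coe
  have : NormOneClass B := ⟨(norm_one : ‖(1 : C(Z, ℂ))‖ = 1)⟩
  exact AlgHom.norm_apply_le_self (𝕜 := ℂ) (A := B) φ f

theorem isNatural_tilde [Nonempty X] (hK : IsCopySequence K Kn)
    (hcl : IsClosed (tilde A Kn h : Set C(X, ℂ))) (H : IsNatural A) :
    IsNatural (tilde A Kn h) := by
  intro φ hφ
  obtain ⟨Φ, hΦ⟩ := exists_algHom_of_ne_zero hφ
  obtain ⟨Y, _, _, _, q, hqs, hq⟩ := hK.exists_quotient ∅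
  -- All copies are collapsed, so `C(Y, ℂ)` pulls back into the algebra; `Φ` restricted to it is
  -- evaluation at some `y = q p`.
  let π : C(Y, ℂ) →ₐ[ℂ] tilde A Kn h :=
    AlgHom.codRestrict (ContinuousMap.compRightAlgHom ℂ ℂ q) (tilde A Kn h) fun g =>
      mem_tilde_iff.2 fun n => mem_of_forall_eq A fun k l => by
        have : q (copyMap h n k) = q (copyMap h n l) :=
          (hq _ _).2 (Or.inr ⟨n, by simp, copyMap_mem h n k, copyMap_mem h n l⟩)
        simp [this]
  obtain ⟨y, hy⟩ := (WeakDual.CharacterSpace.continuousMapEval_bijective (X := Y) (𝕜 := ℂ)).2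
    (WeakDual.CharacterSpace.equivAlgHom.symm (Φ.comp π))
  have hπ : ∀ g : C(Y, ℂ), Φ (π g) = g y := fun g => by
    have := DFunLike.congr_fun hy g
    exact this.symm
  obtain ⟨p, rfl⟩ := hqs y
  -- `Φ` depends only on the values on the fiber through `p`
  have hker : ∀ f : tilde A Kn h, (∀ x, q x = q p → (f : C(X, ℂ)) x = 0) → Φ f = 0 := by
    intro f hf
    rw [← norm_le_zero_iff]
    refine le_of_forall_pos_le_add fun ε hε => ?_
    rw [zero_add]
    obtain ⟨u, hu0, hu1, hu⟩ := exists_continuous_zero_one_of_isClosed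
      (isClosed_singleton (x := q p))
      (q.continuous.isClosedMap _ (isClosed_le_norm (f : C(X, ℂ)) ε))
      (by
        rw [Set.disjoint_singleton_left]
        rintro ⟨x, hx, hxp⟩
        rw [Set.mem_ofPred_eq, hf x hxp, norm_zero] at hx
        exact hε.not_ge hx)
    -- `Φ` kills the multiplier because `u` vanishes at `q p`, and multiplying by it moves `f` by at
    -- most `ε`; contractivity then bounds `Φ f` by `ε`.
    have h0 : Φ (π (complexify u) * f) = 0 := by
      rw [map_mul, hπ, complexify_apply, hu0 rfl]
      simp
    have h1 : Φ f = -Φ (π (complexify u) * f - f) := by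
      rw [map_sub, h0, zero_sub, neg_neg]
    rw [h1, norm_neg]
    refine (norm_apply_le_of_isClosed hcl Φ _).trans ?_
    exact norm_complexify_mul_sub_le (k := u.comp q) (fun x => hu (q x)) hε.le
      fun x hx => hu1 ⟨x, hx, rfl⟩
  have hcongr : ∀ f g : tilde A Kn h,
      (∀ x, q x = q p → (f : C(X, ℂ)) x = (g : C(X, ℂ)) x) → Φ f = Φ g := by
    intro f g hfg
    rw [← sub_eq_zero, ← map_sub]
    exact hker _ fun x hx => sub_eq_zero.2 (hfg x hx)
  -- The fiber is a whole copy, where `Φ` factors through restriction to a character of `A`, or the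
  -- single point `p`, where `f` may be replaced by the constant `f p`.
  by_cases hp : p ∈ ⋃ n, Kn n
  · obtain ⟨n, hn⟩ := Set.mem_iUnion.1 hp
    have hfib : ∀ x, q x = q p → x ∈ Kn n := by
      intro x hx
      rcases (hq x p).1 hx with rfl | ⟨m, -, hxm, hpm⟩
      · exact hn
      · rwa [hK.index_unique hn hpm]
    obtain ⟨χ, hχ⟩ := exists_algHom_factor (hK.restrictHom_surjective (A := A) h n) (Φ := Φ) (by
      intro f hf
      refine hker f fun x hx => ?_
      obtain ⟨k, rfl⟩ := exists_copyMap_eq h (hfib x hx)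
      rw [← restrictHom_apply, hf]
      rfl)
    obtain ⟨k, hk⟩ := H (χ : A →ₙₐ[ℂ] ℂ) (by
      intro h0
      have := DFunLike.congr_fun h0 1
      exact one_ne_zero ((map_one χ).symm.trans this))
    refine ⟨copyMap h n k, fun f => ?_⟩
    rw [← hΦ, ← hχ]
    exact hk _
  · have hfib : ∀ x, q x = q p → x = p := by
      intro x hx
      rcases (hq x p).1 hx with rfl | ⟨m, -, hxm, hpm⟩
      · rfl
      · exact (hp (Set.mem_iUnion.2 ⟨m, hpm⟩)).elim
    refine ⟨p, fun f => ?_⟩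
    rw [← hΦ, hcongr f (algebraMap ℂ _ ((f : C(X, ℂ)) p)), AlgHom.commutes]
    · rfl
    · intro x hx
      rw [hfib x hx]
      rfl

theorem isNatural_tilde_iff [Nonempty X] (hK : IsCopySequence K Kn) (hA : IsUniformAlgebra A) :
    IsNatural (tilde A Kn h) ↔ IsNatural A :=
  ⟨isNatural_of_isNatural_tilde h hK,
    isNatural_tilde h hK (isUniformAlgebra_tilde h hK hA).isClosed⟩

theorem hasBRU_tilde_iff (hK : IsCopySequence K Kn) :
    HasBRU (tilde A Kn h) ↔ HasBRU A :=
  forall_iff_of_copyMap h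
    (fun _ hx => ⟨1, le_rfl, hasBRUAtWith_one_of_notMem_iUnion h hK hx⟩)
    fun _ _ => exists_congr fun _ => and_congr_right (hasBRUAtWith_copyMap_iff h hK)

end Natural

end UniformAlg

end

theorem theorem1p1 {K X : Type*}
    [TopologicalSpace K] [CompactSpace K] [T2Space K] [Nonempty K]
    [MetricSpace X] [CompactSpace X] [Nonempty X]
    (A : Subalgebra ℂ C(K, ℂ)) (hA : UniformAlg.IsUniformAlgebra A) (hA' : A ≠ ⊤)
    (hX : ∀ U : Set X, IsOpen U → U.Nonempty →
      ∃ S : Set X, S ⊆ U ∧ IsNowhereDense S ∧ Nonempty (S ≃ₜ K)) :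
    (∃ Kn : ℕ → Set X, UniformAlg.IsCopySequence K Kn) ∧
    ∀ Kn : ℕ → Set X, UniformAlg.IsCopySequence K Kn → ∀ h : ∀ n, Kn n ≃ₜ K,
      UniformAlg.IsUniformAlgebra (UniformAlg.tilde A Kn h) ∧
      UniformAlg.IsEssential (UniformAlg.tilde A Kn h) ∧
      (∀ n, (fun f : C(X, ℂ) => f.restrict (Kn n)) '' (UniformAlg.tilde A Kn h : Set C(X, ℂ)) =
        (UniformAlg.transport A (h n) : Set C(Kn n, ℂ))) ∧
      (UniformAlg.IsNatural (UniformAlg.tilde A Kn h) ↔ UniformAlg.IsNatural A) ∧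
      (UniformAlg.IsRegularOn (UniformAlg.tilde A Kn h) ↔ UniformAlg.IsRegularOn A) ∧
      (UniformAlg.IsNormal (UniformAlg.tilde A Kn h) ↔ UniformAlg.IsNormal A) ∧
      ((∀ x, UniformAlg.IsPeakPoint (UniformAlg.tilde A Kn h) x) ↔
        ∀ x, UniformAlg.IsPeakPoint A x) ∧
      (UniformAlg.HasBRU (UniformAlg.tilde A Kn h) ↔ UniformAlg.HasBRU A) ∧
      (UniformAlg.IsStronglyRegular (UniformAlg.tilde A Kn h) ↔
        UniformAlg.IsStronglyRegular A) ∧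
      (UniformAlg.IsDitkin (UniformAlg.tilde A Kn h) ↔ UniformAlg.IsDitkin A) ∧
      ∀ x ∉ ⋃ n, Kn n,
        UniformAlg.HasBRUAtWith (UniformAlg.tilde A Kn h) x 1 ∧
        UniformAlg.IsPeakPoint (UniformAlg.tilde A Kn h) x ∧
        UniformAlg.IsDitkinAt (UniformAlg.tilde A Kn h) x ∧
        UniformAlg.IsStronglyRegularAt (UniformAlg.tilde A Kn h) x := by
  refine ⟨UniformAlg.exists_isCopySequence hX, fun Kn hK h => ?_⟩
  have hnat := UniformAlg.isNatural_tilde_iff h hK hA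
  have hout := fun x (hx : x ∉ ⋃ n, Kn n) =>
    UniformAlg.isDitkinAt_of_notMem_iUnion (A := A) h hK hx
  exact ⟨UniformAlg.isUniformAlgebra_tilde h hK hA, UniformAlg.isEssential_tilde h hK hA',
    UniformAlg.IsCopySequence.restrict_image_tilde h hK, hnat,
    UniformAlg.isRegularOn_tilde_iff h hK,
    and_congr hnat (UniformAlg.isNormalOn_tilde_iff h hK),
    UniformAlg.forall_iff_of_copyMap h
      (fun _ hx => UniformAlg.isPeakPoint_of_notMem_iUnion h hK hx)
      fun _ _ => UniformAlg.isPeakPoint_copyMap_iff h hK,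
    UniformAlg.hasBRU_tilde_iff h hK,
    UniformAlg.forall_iff_of_copyMap h (fun x hx => (hout x hx).isStronglyRegularAt)
      fun _ _ => UniformAlg.isStronglyRegularAt_copyMap_iff h hK,
    UniformAlg.forall_iff_of_copyMap h hout fun _ _ => UniformAlg.isDitkinAt_copyMap_iff h hK,
    fun x hx => ⟨UniformAlg.hasBRUAtWith_one_of_notMem_iUnion h hK hx,
      UniformAlg.isPeakPoint_of_notMem_iUnion h hK hx, hout x hx,
      (hout x hx).isStronglyRegularAt⟩⟩
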